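/- Conventions. All alphabets are finite and $\mathbb N\ni 0$. A signature is a finite label set $\Sigma$ with a map $\mathrm{type}:\Sigma\to\mathbb N$. A hypergraph $H$ over it has finite sets $V_H,E_H$ of nodes and hyperedges, a labelling $\mathrm{lab}_H:E_H\to\Sigma$, attachments $\mathrm{att}_H:E_H\to V_H^*$ with $|\mathrm{att}_H(e)|=\mathrm{type}(\mathrm{lab}_H(e))$, and a sequence $\mathrm{ext}_H\in V_H^*$ of external nodes; its type is $|\mathrm{ext}_H|$, and it is repetition-free if $\mathrm{ext}_H$ has no repeated node. Isomorphisms preserve attachments, labels and the external sequence. The handle $X^\bullet$ of a label $X$ of type $n$ has nodes $v_1,\dots,v_n$, one $X$-labelled hyperedge attached to $v_1\cdots v_n$, and external nodes $v_1\cdots v_n$. The string graph of $w=x_1\cdots x_n$ (all $x_i$ of type $2$) has nodes $v_0,\dots,v_n$, hyperedges $e_i$ labelled $x_i$ and attached to $v_{i-1}v_i$ ($1\le i\le n$), and external nodes $v_0v_n$; any hypergraph isomorphic to it represents $w$. A table over the signature is a finite set of rules $(X,R)$, with $X\in\Sigma$ and $R$ a hypergraph of type $\mathrm{type}(X)$,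 containing at least one rule for each $X\in\Sigma$. A parallel direct derivation with a table replaces every hyperedge $e$ of $H$ simultaneously by some $R_e$ with $(\mathrm{lab}_H(e),R_e)$ in the table, identifying the $i$-th external node of $R_e$ with the $i$-th attachment node of $e$ (the result is taken up to isomorphism and keeps the external nodes of $H$). A PHR grammar of order $k$ with at most $l$ tables consists of a signature, a set of terminal labels, a start label $S$, and a non-empty set of at most $l$ tables all of whose rules have type at most $k$; it is repetition-free if all right-hand sides of its rules are. It generates the set of all hypergraphs with only terminal labels obtained from $S^\bullet$ by finitely many (possibly zero) parallel direct derivations, each with any one of its tables. A language $L\subseteq A^*$ is a (repetition-free) $k$-PHRS language if, for some $l\ge1$, some (repetition-free) PHR grammar of order $k$ with at most $l$ tables generates only string graphs and the set of strings they represent is $L\setminus\{\epsilon\}$. Write $\mathcal{PHRS}_k$ and $\mathcal{PHRS}_k^{\mathrm{rf}}$ for these families. For a family $\mathcal F$ of string languages, an $\mathcal F$-substitution on $A$ is here a map $h$ assigning to each $a\in A$ a non-empty language $h(a)\subseteq A^*$ in $\mathcal F$; it is non-erasing if $\epsilon\notin h(a)$ for all $a\in A$. For $L\subseteq A^*$ put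 $h(L)=\{w_1\cdots w_n : x_1\cdots x_n\in L,\ w_i\in h(x_i)\}$, and for a set $H$ of substitutions put $$\mathrm{ITER}_H(L)=\bigcup_{n\in\mathbb N}\ \bigcup_{h_1,\dots,h_n\in H}h_n(\cdots h_1(L)\cdots).$$ Theorem. Let $L\subseteq A^*$, let $k\ge2$, and let $H$ be a finite set of substitutions on $A$. 1. If $L$ is a $k$-PHRS language and every $h\in H$ is a $\mathcal{PHRS}_k$-substitution, then $\mathrm{ITER}_H(L)$ is a $k$-PHRS language. 2. If $L$ is a repetition-free $k$-PHRS language and every $h\in H$ is a non-erasing $\mathcal{PHRS}_k^{\mathrm{rf}}$-substitution, then $\mathrm{ITER}_H(L)$ is a repetition-free $k$-PHRS language. -/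

import Mathlib

universe u

/-! ## Hypergraphs over a signature

A signature is a finite label set `Λ` with a typing function `ty : Λ → ℕ`. -/

/-- A hypergraph over the signature `(Λ, ty)`: finite sets of nodes and hyperedges, an attachment
function, a labelling function compatible with typing, and a sequence of external nodes. -/
structure HRHypergraph {Λ : Type u} (ty : Λ → ℕ) where
  V : Type
  E : Type
  finiteV : Finite V
  finiteE : Finite E
  att : E → List V
  lab : E → Λ
  extNodes : List V
  att_length : ∀ e, (att e).length = ty (lab e)

namespace HRHypergraph

variable {Λ : Type u} {ty : Λ → ℕ}

/-- The type of a hypergraph: its number of external nodes. -/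
def arity (H : HRHypergraph ty) : ℕ := H.extNodes.length

/-- A hypergraph is repetition-free if no external node is repeated. -/
def RepetitionFree (H : HRHypergraph ty) : Prop := H.extNodes.Nodup

/-- Isomorphism: bijections on nodes and hyperedges respecting attachments, labels and the sequence
of external nodes. -/
def Iso (G H : HRHypergraph ty) : Prop :=
  ∃ (gV : G.V ≃ H.V) (gE : G.E ≃ H.E),
    (∀ e, H.att (gE e) = (G.att e).map gV) ∧
    (∀ e, H.lab (gE e) = G.lab e) ∧
    H.extNodes = G.extNodes.map gV

/-- The handle of a label `X` of type `n`: nodes `v₁, …, vₙ`, one `X`-labelled hyperedge attached to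
`v₁ ⋯ vₙ`, and external nodes `v₁ ⋯ vₙ`. -/
def handle (ty : Λ → ℕ) (X : Λ) : HRHypergraph ty where
  V := Fin (ty X)
  E := Unit
  finiteV := inferInstance
  finiteE := inferInstance
  att := fun _ => List.finRange (ty X)
  lab := fun _ => X
  extNodes := List.finRange (ty X)
  att_length := by simp

/-- The string graph of a string `w = x₁ ⋯ xₙ` of labels of type `2`: nodes `v₀, …, vₙ`, hyperedges
`e₁, …, eₙ` where `eᵢ` is labelled by `xᵢ` and attached to `vᵢ₋₁ vᵢ`, and external nodes `v₀ vₙ`. -/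
def stringGraph (ty : Λ → ℕ) (w : List Λ) (hw : ∀ x ∈ w, ty x = 2) : HRHypergraph ty where
  V := Fin (w.length + 1)
  E := Fin w.length
  finiteV := inferInstance
  finiteE := inferInstance
  att := fun i => [i.castSucc, i.succ]
  lab := fun i => w.get i
  extNodes := [0, Fin.last w.length]
  att_length := fun i => (hw _ (List.get_mem w i)).symm

/-- `H` is a string graph representing the string `w`. -/
def Represents (H : HRHypergraph ty) (w : List Λ) : Prop :=
  ∃ hw : ∀ x ∈ w, ty x = 2, H.Iso (stringGraph ty w hw)

/-- The elementary node identifications in the replacement of every hyperedge `e` of `H` by `σ e`: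
the `i`-th external node of `σ e` is identified with the `i`-th attachment node of `e`. -/
inductive Glue (H : HRHypergraph ty) (σ : H.E → HRHypergraph ty) :
    H.V ⊕ ((e : H.E) × (σ e).V) → H.V ⊕ ((e : H.E) × (σ e).V) → Prop
  | mk (e : H.E) (i : ℕ) (x : H.V) (v : (σ e).V) :
      (H.att e)[i]? = some x → (σ e).extNodes[i]? = some v →
      Glue H σ (Sum.inr ⟨e, v⟩) (Sum.inl x)

theorem finite_quot_glue (H : HRHypergraph ty) (σ : H.E → HRHypergraph ty) :
    Finite (Quot (Glue H σ)) := by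
  have := H.finiteV
  have := H.finiteE
  have : ∀ e, Finite (σ e).V := fun e => (σ e).finiteV
  infer_instance

theorem finite_sigma_edges (H : HRHypergraph ty) (σ : H.E → HRHypergraph ty) :
    Finite ((e : H.E) × (σ e).E) := by
  have := H.finiteE
  have : ∀ e, Finite (σ e).E := fun e => (σ e).finiteE
  infer_instance

/-- The simultaneous replacement `H[e₁/σ(e₁), …, eₙ/σ(eₙ)]` of all hyperedges `e₁, …, eₙ` of `H`:
the hyperedges of `H` are removed, the nodes and hyperedges of each `σ e` are added disjointly, and
the `i`-th external node of `σ e` is identified with the `i`-th attachment node of `e`. The external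
nodes are those of `H`. (Only used when the type of `σ e` is that of the label of `e`.) -/
def replace (H : HRHypergraph ty) (σ : H.E → HRHypergraph ty) : HRHypergraph ty where
  V := Quot (Glue H σ)
  E := (e : H.E) × (σ e).E
  finiteV := finite_quot_glue H σ
  finiteE := finite_sigma_edges H σ
  att := fun p => ((σ p.1).att p.2).map (fun v => Quot.mk _ (Sum.inr ⟨p.1, v⟩))
  lab := fun p => (σ p.1).lab p.2
  extNodes := H.extNodes.map (fun x => Quot.mk _ (Sum.inl x))
  att_length := fun p => by simpa using (σ p.1).att_length p.2

end HRHypergraph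

/-! ## Parallel hyperedge replacement grammars -/

/-- A table: a finite set of rules `(X, R)`, where the type of the hypergraph `R` is that of the
label `X`, with at least one rule for every label. -/
structure PHRTable {Λ : Type u} (ty : Λ → ℕ) where
  rules : Set (Λ × HRHypergraph ty)
  finite_rules : rules.Finite
  arity_eq : ∀ r ∈ rules, r.2.arity = ty r.1
  total : ∀ X : Λ, ∃ R, (X, R) ∈ rules

/-- Parallel direct derivation with a table `T`: every hyperedge is replaced by the right-hand side
of some rule of `T` for its label; the result is taken up to isomorphism. -/
def PHRTable.Step {Λ : Type u} {ty : Λ → ℕ} (T : PHRTable ty) (H H' : HRHypergraph ty) : Prop :=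
  ∃ σ : H.E → HRHypergraph ty, (∀ e, (H.lab e, σ e) ∈ T.rules) ∧ H'.Iso (H.replace σ)

/-- A parallel hyperedge replacement grammar over the signature `(Λ, ty)`. -/
structure PHRGrammar {Λ : Type u} (ty : Λ → ℕ) where
  terminals : Set Λ
  start : Λ
  tables : Set (PHRTable ty)
  finite_tables : tables.Finite
  nonempty_tables : tables.Nonempty

namespace PHRGrammar

variable {Λ : Type u} {ty : Λ → ℕ}

/-- The grammar has order `k`: all rules have type at most `k`. -/
def HasOrder (G : PHRGrammar ty) (k : ℕ) : Prop :=
  ∀ T ∈ G.tables, ∀ r ∈ T.rules, r.2.arity ≤ k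

/-- The grammar is repetition-free: all right-hand sides of rules are repetition-free. -/
def RepetitionFree (G : PHRGrammar ty) : Prop :=
  ∀ T ∈ G.tables, ∀ r ∈ T.rules, r.2.RepetitionFree

/-- Parallel derivation: a sequence of parallel direct derivations using tables of the grammar, or an
isomorphism. -/
def Derives (G : PHRGrammar ty) (H H' : HRHypergraph ty) : Prop :=
  H.Iso H' ∨ Relation.TransGen (fun H₁ H₂ => ∃ T ∈ G.tables, T.Step H₁ H₂) H H'

/-- The generated hypergraph language: the terminally labelled hypergraphs derivable from the handle
of the start symbol. -/
def language (G : PHRGrammar ty) : Set (HRHypergraph ty) :=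
  {H | G.Derives (HRHypergraph.handle ty G.start) H ∧ ∀ e, H.lab e ∈ G.terminals}

/-- The grammar generates a string graph language. -/
def GeneratesStringGraphs (G : PHRGrammar ty) : Prop :=
  ∀ H ∈ G.language, ∃ w, H.Represents w

/-- The strings represented by the string graphs generated by the grammar. -/
def strings (G : PHRGrammar ty) : Language Λ :=
  {w | ∃ H ∈ G.language, H.Represents w}

end PHRGrammar

/-! ## String languages

Below, `α` is a finite alphabet. Its letters become labels of the grammar through the injection
`ι : α ↪ Λ`, so that strings over `α` are identified with certain strings over `Λ`. -/

/-- `L` is a PHRS language of order `k` with at most `l` tables: some grammar of order `k` with at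
most `l` tables generates a string graph language whose strings are exactly the non-empty ones
of `L`. -/
def IsPHRSWith {α : Type u} (k l : ℕ) (L : Language α) : Prop :=
  ∃ (Λ : Type u) (_ : Finite Λ) (ty : Λ → ℕ) (ι : α ↪ Λ) (G : PHRGrammar ty),
    G.HasOrder k ∧ G.tables.ncard ≤ l ∧ G.GeneratesStringGraphs ∧
    G.strings = {w | ∃ u ∈ L, u ≠ [] ∧ u.map ι = w}

/-- The repetition-free version of `IsPHRSWith`. -/
def IsRFPHRSWith {α : Type u} (k l : ℕ) (L : Language α) : Prop :=
  ∃ (Λ : Type u) (_ : Finite Λ) (ty : Λ → ℕ) (ι : α ↪ Λ) (G : PHRGrammar ty),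
    G.RepetitionFree ∧
    G.HasOrder k ∧ G.tables.ncard ≤ l ∧ G.GeneratesStringGraphs ∧
    G.strings = {w | ∃ u ∈ L, u ≠ [] ∧ u.map ι = w}

/-- `L` is a `k`-PHRS language. -/
def IsPHRS {α : Type u} (k : ℕ) (L : Language α) : Prop :=
  ∃ l, 1 ≤ l ∧ IsPHRSWith k l L

/-- `L` is a repetition-free `k`-PHRS language. -/
def IsRFPHRS {α : Type u} (k : ℕ) (L : Language α) : Prop :=
  ∃ l, 1 ≤ l ∧ IsRFPHRSWith k l L

/-- For a family `F` of string languages, `h` is an `F`-substitution of strings: every `h a` is a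
non-empty language belonging to `F`. -/
def IsSubstitution {α : Type u} (F : Language α → Prop) (h : α → Language α) : Prop :=
  ∀ a, (∃ w, w ∈ h a) ∧ F (h a)

/-- A substitution is non-erasing if the empty string belongs to no `h a`. -/
def NonErasing {α : Type u} (h : α → Language α) : Prop :=
  ∀ a, [] ∉ h a

/-- The image `h(L)`: all concatenations `w₁ ⋯ wₙ` with `wᵢ ∈ h(xᵢ)` for some `x₁ ⋯ xₙ ∈ L`. -/
def substImage {α : Type u} (h : α → Language α) (L : Language α) : Language α :=
  {w | ∃ x ∈ L, ∃ ws : List (List α), List.Forall₂ (fun a v => v ∈ h a) x ws ∧ w = ws.flatten}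

/-- `ITER_H(L)`: the union of all `hₙ(⋯ h₁(L) ⋯)` with `n ≥ 0` and `h₁, …, hₙ ∈ H`. -/
def ITER {α : Type u} (H : Set (α → Language α)) (L : Language α) : Language α :=
  {w | ∃ hs : List (α → Language α), (∀ h ∈ hs, h ∈ H) ∧
    w ∈ hs.foldl (fun K h => substImage h K) L}

/-! One grammar simulates an entire iteration, given a grammar `P none` for `L` and a grammar `P
(some (j, a))` for each language `s j a`, where `s j` is the `j`-th substitution. A sentential form
is a path whose finished letters are labelled `done`; a table `round j` turns every letter `a` into
a request `wait (some (j, a))`. A request may persist, or become the start label of its grammar,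
which is then driven by the tables `run i t`; the table `finish` turns the resulting letters into
`done` ones.

The difficulty is parallelism: a table acts on all hyperedges at once, yet different occurrences of
one letter must be able to receive different strings. Requests and finished letters may idle under
`run` and `finish`, so requests are served one after another. Active labels cannot idle: under a
table that does not fit them they can only yield the irremovable label `dead`. Hence every active
copy of a grammar sees one common sequence of its own tables, so what it derives is a genuine
derivation of that grammar.

The empty string needs separate care, because the given grammars produce only its complement, while
the new grammar must not produce it. A request may be erased outright if the requested language
contains the empty string, and a Boolean flag records that a nonempty string is still owed. The
start request carries the flag, and a flagged hyperedge always passes it on to at least one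
successor. Erasure is the only new rule with a repeated external node, which is why the
repetition-free case asks for non-erasing substitutions.

Everything rests on context-freeness: derivations split at the first step (`Gen`, via
`replace_assoc`), and substituting string graphs into a path concatenates strings
(`replace_represents`). `cGen_sound` then bounds the generated strings from above, and
`exists_yields_start` produces all of them. -/

namespace HRHypergraph

/-! ### Isomorphism of hypergraphs. -/

section Iso

variable {Λ : Type u} {ty : Λ → ℕ} {G H K : HRHypergraph ty}

theorem Iso.refl (H : HRHypergraph ty) : H.Iso H :=
  ⟨Equiv.refl _, Equiv.refl _, by simp, by simp, by simp⟩

theorem Iso.symm (h : G.Iso H) : H.Iso G := by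
  obtain ⟨gV, gE, ha, hl, hx⟩ := h
  refine ⟨gV.symm, gE.symm, fun e => ?_, fun e => ?_, ?_⟩
  · have := ha (gE.symm e)
    simp only [Equiv.apply_symm_apply] at this
    simp [this]
  · have := hl (gE.symm e)
    simpa using this.symm
  · simp [hx]

theorem Iso.trans (h : G.Iso H) (h' : H.Iso K) : G.Iso K := by
  obtain ⟨gV, gE, ha, hl, hx⟩ := h
  obtain ⟨gV', gE', ha', hl', hx'⟩ := h'
  exact ⟨gV.trans gV', gE.trans gE', fun e => by simp [ha', ha], fun e => by simp [hl', hl],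
    by simp [hx', hx]⟩

theorem Iso.arity_eq (h : G.Iso H) : G.arity = H.arity := by
  obtain ⟨gV, gE, ha, hl, hx⟩ := h
  simp [arity, hx]

theorem Represents.of_iso {w : List Λ} (h : G.Iso H) (hH : H.Represents w) : G.Represents w := by
  obtain ⟨hw, hi⟩ := hH
  exact ⟨hw, h.trans hi⟩

end Iso

/-! ### Simultaneous replacement: universal property, units, associativity. -/

section Replace

variable {Λ : Type u} {ty : Λ → ℕ}

/-- The node of `H.replace σ` coming from a node of `H`. -/
def outerNode (H : HRHypergraph ty) (σ : H.E → HRHypergraph ty) (x : H.V) : (H.replace σ).V :=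
  Quot.mk _ (Sum.inl x)

/-- The node of `H.replace σ` coming from a node of `σ e`. -/
def innerNode (H : HRHypergraph ty) (σ : H.E → HRHypergraph ty) (e : H.E) (v : (σ e).V) :
    (H.replace σ).V :=
  Quot.mk _ (Sum.inr ⟨e, v⟩)

variable {H : HRHypergraph ty} {σ : H.E → HRHypergraph ty}

theorem innerNode_eq_outerNode {e : H.E} {i : ℕ} {x : H.V} {v : (σ e).V}
    (hx : (H.att e)[i]? = some x) (hv : (σ e).extNodes[i]? = some v) :
    innerNode H σ e v = outerNode H σ x :=
  Quot.sound (Glue.mk e i x v hx hv)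

theorem replace_node_induction {P : (H.replace σ).V → Prop} (ho : ∀ x, P (outerNode H σ x))
    (hi : ∀ e v, P (innerNode H σ e v)) (p : (H.replace σ).V) : P p := by
  obtain ⟨x | ⟨e, v⟩⟩ := p
  exacts [ho x, hi e v]

/-- The universal property of the set of nodes of `H.replace σ`. -/
def replaceDesc {W : Type} (a : H.V → W) (b : ∀ e, (σ e).V → W)
    (h : ∀ (e : H.E) (i : ℕ) (x : H.V) (v : (σ e).V),
      (H.att e)[i]? = some x → (σ e).extNodes[i]? = some v → b e v = a x) :
    (H.replace σ).V → W :=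
  Quot.lift (Sum.elim a fun p => b p.1 p.2) (by rintro _ _ ⟨e, i, x, v, hx, hv⟩; exact h e i x v hx hv)

theorem replaceDesc_outerNode {W : Type} (a : H.V → W) (b : ∀ e, (σ e).V → W) (h) (x : H.V) :
    replaceDesc (σ := σ) a b h (outerNode H σ x) = a x := rfl

theorem replaceDesc_innerNode {W : Type} (a : H.V → W) (b : ∀ e, (σ e).V → W) (h) (e : H.E)
    (v : (σ e).V) : replaceDesc (σ := σ) a b h (innerNode H σ e v) = b e v := rfl

theorem replace_att (e : H.E) (e' : (σ e).E) :
    (H.replace σ).att ⟨e, e'⟩ = ((σ e).att e').map (innerNode H σ e) := rfl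

theorem replace_extNodes : (H.replace σ).extNodes = H.extNodes.map (outerNode H σ) := rfl

theorem getElem?_map_eq_some {A B : Type*} {f : A → B} {l : List A} {i : ℕ} {y : B} :
    (l.map f)[i]? = some y ↔ ∃ a, l[i]? = some a ∧ f a = y := by
  rw [List.getElem?_map, Option.map_eq_some_iff]

theorem map_finRange_eq_map {A B : Type*} {n : ℕ} {l : List A} (hl : l.length = n) {f : Fin n → B}
    {g : A → B} (h : ∀ i : Fin n, f i = g (l.get (i.cast hl.symm))) :
    (List.finRange n).map f = l.map g := by
  subst hl
  exact List.ext_getElem (by simp) fun i h1 h2 => by simpa using h ⟨i, by simpa using h2⟩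

theorem map_map_eq_map_map {A B C D : Type*} {l : List A} {f : A → B} {g : B → D} {f' : A → C}
    {g' : C → D} (h : ∀ a, g (f a) = g' (f' a)) : (l.map f).map g = (l.map f').map g' := by
  simp [h]

theorem finRange_getElem? {n : ℕ} (v : Fin n) : (List.finRange n)[(v : ℕ)]? = some v := by simp

theorem glue_inr_inl {e : H.E} {v : (σ e).V} {x : H.V} :
    Glue H σ (Sum.inr ⟨e, v⟩) (Sum.inl x) ↔
      ∃ i : ℕ, (H.att e)[i]? = some x ∧ (σ e).extNodes[i]? = some v :=
  ⟨fun h => by cases h with | mk e i x v hx hv => exact ⟨i, hx, hv⟩,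
    fun ⟨i, hx, hv⟩ => Glue.mk e i x v hx hv⟩

/-- Replacement is invariant under isomorphism; the labels of the outer hypergraph are irrelevant. -/
theorem replace_congr {H' : HRHypergraph ty} {σ' : H'.E → HRHypergraph ty} (gV : H.V ≃ H'.V)
    (gE : H.E ≃ H'.E) (ha : ∀ e, H'.att (gE e) = (H.att e).map gV)
    (hx : H'.extNodes = H.extNodes.map gV) (hσ : ∀ e, (σ e).Iso (σ' (gE e))) :
    (H.replace σ).Iso (H'.replace σ') := by
  choose fV fE hfa hfl hfx using hσ
  refine ⟨Quot.congr (Equiv.sumCongr gV (Equiv.sigmaCongr gE fV)) ?_, Equiv.sigmaCongr gE fE,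
    ?_, ?_, ?_⟩
  · rintro (x | ⟨e, v⟩) (y | ⟨e', v'⟩)
    · exact ⟨by rintro ⟨⟩, by rintro ⟨⟩⟩
    · exact ⟨by rintro ⟨⟩, by rintro ⟨⟩⟩
    · change _ ↔ Glue H' σ' (Sum.inr ⟨gE e, fV e v⟩) (Sum.inl (gV y))
      simp only [glue_inr_inl, ha, hfx, getElem?_map_eq_some]
      simp
    · exact ⟨by rintro ⟨⟩, by rintro ⟨⟩⟩
  · rintro ⟨e, e'⟩
    exact (congrArg (List.map _) (hfa e e')).trans (map_map_eq_map_map fun v => rfl)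
  · rintro ⟨e, e'⟩
    exact hfl e e'
  · rw [replace_extNodes, replace_extNodes, hx, List.map_map, List.map_map]
    rfl

theorem replace_congr_right {σ' : H.E → HRHypergraph ty} (hσ : ∀ e, (σ e).Iso (σ' e)) :
    (H.replace σ).Iso (H.replace σ') :=
  replace_congr (Equiv.refl _) (Equiv.refl _) (by simp) (by simp) hσ

theorem replace_handle (H : HRHypergraph ty) :
    (H.replace fun e => handle ty (H.lab e)).Iso H := by
  refine Iso.symm ⟨⟨outerNode H _, replaceDesc id
    (fun e (v : Fin (ty (H.lab e))) => (H.att e).get (v.cast (H.att_length e).symm)) ?_, ?_, ?_⟩,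
    ⟨fun e => ⟨e, ()⟩, fun p => p.1, fun _ => rfl, fun ⟨_, _⟩ => rfl⟩, ?_, ?_, ?_⟩
  · intro e i x v hx hv
    change (List.finRange _)[i]? = some v at hv
    obtain ⟨hi, rfl⟩ := List.getElem?_eq_some_iff.1 hx
    obtain ⟨hi', rfl⟩ := List.getElem?_eq_some_iff.1 hv
    simp
  · intro x
    rfl
  · refine replace_node_induction (fun x => rfl) (fun e v => ?_)
    exact (innerNode_eq_outerNode (i := Fin.val (n := ty (H.lab e)) v)
      (List.getElem?_eq_getElem _) (finRange_getElem? (n := ty (H.lab e)) v)).symm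
  · intro e
    exact map_finRange_eq_map (H.att_length e) fun i => innerNode_eq_outerNode (i := i)
      (List.getElem?_eq_getElem _) (finRange_getElem? i)
  · intro e
    rfl
  · rfl

theorem handle_replace (X : Λ) (σ : Unit → HRHypergraph ty) (h : (σ ()).arity = ty X) :
    ((handle ty X).replace σ).Iso (σ ()) := by
  refine Iso.symm ⟨⟨innerNode (handle ty X) σ (), replaceDesc
    (fun v : Fin (ty X) => (σ ()).extNodes.get (v.cast h.symm)) (fun _ => id) ?_, ?_, ?_⟩,
    ⟨fun e => ⟨(), e⟩, fun p => p.2, fun _ => rfl, fun ⟨_, _⟩ => rfl⟩, ?_, ?_, ?_⟩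
  · rintro ⟨⟩ i x v hx hv
    change (List.finRange _)[i]? = some x at hx
    obtain ⟨hi, rfl⟩ := List.getElem?_eq_some_iff.1 hx
    obtain ⟨hi', rfl⟩ := List.getElem?_eq_some_iff.1 hv
    simp
    rfl
  · intro x
    rfl
  · refine replace_node_induction (fun v => ?_) (fun e v => rfl)
    exact innerNode_eq_outerNode (H := handle ty X) (i := Fin.val (n := ty X) v)
      (finRange_getElem? (n := ty X) v) (List.getElem?_eq_getElem _)
  · intro e
    rfl
  · intro e
    rfl
  · exact map_finRange_eq_map h fun i => (innerNode_eq_outerNode (H := handle ty X) (i := i)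
      (finRange_getElem? i) (List.getElem?_eq_getElem _)).symm

/-- Both sides are the same iterated gluing, so the universal property gives mutually inverse maps
on nodes. This is what makes derivations context-free. -/
theorem replace_assoc (H : HRHypergraph ty) (σ : H.E → HRHypergraph ty)
    (τ : (H.replace σ).E → HRHypergraph ty) :
    ((H.replace σ).replace τ).Iso
      (H.replace fun e => (σ e).replace fun e' => τ ⟨e, e'⟩) := by
  refine ⟨⟨replaceDesc (replaceDesc (outerNode H _)
      (fun e v => innerNode H _ e (outerNode (σ e) _ v)) ?_)
      (fun p v => innerNode H _ p.1 (innerNode (σ p.1) _ p.2 v)) ?_,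
    replaceDesc (fun x => outerNode _ _ (outerNode H σ x))
      (fun e => replaceDesc (fun v => outerNode _ _ (innerNode H σ e v))
        (fun e' v => innerNode _ _ ⟨e, e'⟩ v) ?_) ?_, ?_, ?_⟩,
    ⟨fun p => ⟨p.1.1, p.1.2, p.2⟩, fun p => ⟨⟨p.1, p.2.1⟩, p.2.2⟩, fun _ => rfl, fun _ => rfl⟩,
    ?_, ?_, ?_⟩
  · intro e i x v hx hv
    exact innerNode_eq_outerNode hx (by rw [replace_extNodes, List.getElem?_map, hv]; rfl)
  · rintro ⟨e, e'⟩ i x v hx hv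
    rw [replace_att, getElem?_map_eq_some] at hx
    obtain ⟨y, hy, rfl⟩ := hx
    rw [replaceDesc_innerNode]
    exact congrArg _ (innerNode_eq_outerNode hy hv)
  · intro e' i x v hx hv
    exact innerNode_eq_outerNode (by rw [replace_att, List.getElem?_map, hx]; rfl) hv
  · intro e i x v hx hv
    rw [replace_extNodes, getElem?_map_eq_some] at hv
    obtain ⟨y, hy, rfl⟩ := hv
    rw [replaceDesc_outerNode]
    exact congrArg _ (innerNode_eq_outerNode hx hy)
  · refine replace_node_induction (replace_node_induction (fun x => rfl) fun e v => rfl)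
      fun p v => rfl
  · refine replace_node_induction (fun x => rfl) fun e => replace_node_induction (fun x => rfl)
      fun e' v => rfl
  · rintro ⟨⟨e, e'⟩, e''⟩
    exact map_map_eq_map_map (l := (τ ⟨e, e'⟩).att e'') fun v => rfl
  · intro p
    rfl
  · simp only [replace_extNodes, List.map_map]
    rfl

/-- The relabelling of a hypergraph over one signature in another one. -/
def relabel {Λ' : Type*} {ty' : Λ' → ℕ} (H : HRHypergraph ty) (f : H.E → Λ')
    (hf : ∀ e, ty' (f e) = ty (H.lab e)) : HRHypergraph ty' where
  V := H.V
  E := H.E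
  finiteV := H.finiteV
  finiteE := H.finiteE
  att := H.att
  lab := f
  extNodes := H.extNodes
  att_length := fun e => by rw [hf]; exact H.att_length e

/-- Gluing sees attachments and external nodes but never labels, so associativity survives a change
of signature. It transports derivations between a given grammar and the combined one. -/
theorem relabel_replace {Λ' : Type*} {ty' : Λ' → ℕ} (H : HRHypergraph ty)
    (σ : H.E → HRHypergraph ty) (f : (H.replace σ).E → Λ')
    (hf : ∀ p, ty' (f p) = ty ((H.replace σ).lab p)) (g : H.E → Λ')
    (hg : ∀ e, ty' (g e) = ty (H.lab e)) (τ : (H.replace σ).E → HRHypergraph ty') :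
    (((H.replace σ).relabel f hf).replace τ).Iso
      ((H.relabel g hg).replace fun e =>
        ((σ e).relabel (fun e' => f ⟨e, e'⟩) fun e' => hf ⟨e, e'⟩).replace fun e' => τ ⟨e, e'⟩) := by
  refine (replace_congr (H := (H.replace σ).relabel f hf)
    (H' := (H.relabel g hg).replace
      fun e => (σ e).relabel (fun e' => f ⟨e, e'⟩) fun e' => hf ⟨e, e'⟩)
    (Quot.congr (Equiv.refl _) ?_) (Equiv.refl _) ?_ ?_ fun p => Iso.refl (τ p)).trans
    (replace_assoc (H.relabel g hg) _ _)
  · rintro (x | ⟨e, v⟩) (y | ⟨e', v'⟩)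
    · exact ⟨by rintro ⟨⟩, by rintro ⟨⟩⟩
    · exact ⟨by rintro ⟨⟩, by rintro ⟨⟩⟩
    · refine glue_inr_inl.trans (Iff.symm ?_)
      exact glue_inr_inl (H := H.relabel g hg)
        (σ := fun e => (σ e).relabel (fun e' => f ⟨e, e'⟩) fun e' => hf ⟨e, e'⟩)
    · exact ⟨by rintro ⟨⟩, by rintro ⟨⟩⟩
  · rintro ⟨e, e'⟩
    exact (List.map_id _).symm.trans
      (map_map_eq_map_map (l := (σ e).att e') (f' := innerNode H σ e) fun v => rfl)
  · exact (List.map_id _).symm.trans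
      (map_map_eq_map_map (l := H.extNodes) (f' := outerNode H σ) fun v => rfl)

end Replace

end HRHypergraph

/-! ### Positions in a concatenation as prefix sums of lengths. -/

theorem List.flatten_getElem?_take {A : Type*} (L : List (List A)) {i : ℕ} (hi : i < L.length)
    {j : ℕ} (hj : j < L[i].length) :
    L.flatten[((L.take i).map List.length).sum + j]? = some (L[i][j]) := by
  induction L generalizing i with
  | nil => simp at hi
  | cons l L ih =>
    cases i with
    | zero =>
      simp only [List.getElem_cons_zero] at hj ⊢
      simp [List.getElem?_append_left hj]
    | succ i =>
      simp only [List.getElem_cons_succ] at hj ⊢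
      have := ih (by simpa using hi) hj
      rw [List.flatten_cons, List.getElem?_append_right (by simp; omega), ← this]
      congr 1
      simp; omega

theorem List.sum_length_take {A : Type*} (L : List (List A)) (i : ℕ) (hi : i ≤ L.length) :
    ∑ k : Fin i, (L.get (Fin.castLE hi k)).length = ((L.take i).map List.length).sum := by
  rw [← List.sum_ofFn]
  congr 1
  refine List.ext_getElem (by simp [hi]) fun n h1 h2 => by simp

/-! ### String graphs and concatenation. -/

namespace HRHypergraph

variable {Λ : Type u} {ty : Λ → ℕ}

theorem stringGraph_iso_stringGraph {w w' : List Λ} {hw : ∀ x ∈ w, ty x = 2}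
    {hw' : ∀ x ∈ w', ty x = 2} (h : (stringGraph ty w hw).Iso (stringGraph ty w' hw')) :
    w = w' := by
  obtain ⟨gV, gE, ha, hl, hx⟩ := h
  change Fin (w.length + 1) ≃ Fin (w'.length + 1) at gV
  change Fin w.length ≃ Fin w'.length at gE
  have hlen : w.length = w'.length := by simpa using Fintype.card_congr gE
  change ∀ e, [(gE e).castSucc, (gE e).succ] = [gV e.castSucc, gV e.succ] at ha
  change ∀ e, w'.get (gE e) = w.get e at hl
  change [0, Fin.last _] = [gV 0, gV (Fin.last _)] at hx
  simp only [List.cons.injEq, and_true] at ha hx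
  -- A directed path is rigid: its first node is fixed by the external sequence, and each hyperedge
  -- determines the next node.
  have key : ∀ i : Fin (w.length + 1), (gV i : ℕ) = i := by
    intro i
    induction i using Fin.induction with
    | zero => rw [← hx.1]; simp
    | succ i ih =>
      have h1 := congrArg Fin.val (ha i).1
      have h2 := congrArg Fin.val (ha i).2
      simp only [Fin.val_castSucc, Fin.val_succ] at *
      omega
  refine List.ext_get hlen fun i h1 h2 => ?_
  rw [← hl ⟨i, h1⟩]
  congr 1
  have h3 := congrArg Fin.val (ha ⟨i, h1⟩).1
  rw [key] at h3
  exact Fin.ext h3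

theorem Represents.unique {H : HRHypergraph ty} {w w' : List Λ} (h : H.Represents w)
    (h' : H.Represents w') : w = w' := by
  obtain ⟨hw, i⟩ := h
  obtain ⟨hw', i'⟩ := h'
  exact stringGraph_iso_stringGraph (i.symm.trans i')

/-- A hypergraph shaped like a string graph, with the given labels on its hyperedges. -/
def pathGraph {n : ℕ} (l : Fin n → Λ) (hl : ∀ i, ty (l i) = 2) : HRHypergraph ty where
  V := Fin (n + 1)
  E := Fin n
  finiteV := inferInstance
  finiteE := inferInstance
  att := fun i => [i.castSucc, i.succ]
  lab := l
  extNodes := [0, Fin.last n]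
  att_length := fun i => (hl i).symm

/-- Node `v` of the `e`-th factor goes to position `S e + v`, with `S` the prefix sums of lengths.
Empty factors are allowed: their single node, external twice, merges the two ends of its hyperedge.
-/
theorem pathGraph_replace_represents (L : List (List Λ)) (l : Fin L.length → Λ)
    (hl : ∀ i, ty (l i) = 2) (hL : ∀ i, ∀ x ∈ L.get i, ty x = 2) :
    ((pathGraph l hl).replace fun i => stringGraph ty (L.get i) (hL i)).Represents L.flatten := by
  set σ : (pathGraph l hl).E → HRHypergraph ty := fun i => stringGraph ty (L.get i) (hL i) with hσ
  have hw : ∀ x ∈ L.flatten, ty x = 2 := by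
    intro x hx
    obtain ⟨v, hv, hxv⟩ := List.mem_flatten.1 hx
    obtain ⟨i, rfl⟩ := List.mem_iff_get.1 hv
    exact hL i x hxv
  set N := L.flatten.length with hN
  let S : ℕ → ℕ := fun i => ((L.take i).map List.length).sum
  have hS0 : S 0 = 0 := by simp [S]
  have hSs : ∀ i : Fin L.length, S (i + 1) = S i + (L.get i).length := by
    intro i
    simp [S]
  have hSN : S L.length = N := by
    simp only [S, hN, List.length_flatten, List.take_length]
  have hcard : ∑ i : Fin L.length, (L.get i).length = N := by
    rw [← hSN]
    exact List.sum_length_take L L.length le_rfl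
  let φ : ((i : Fin L.length) × Fin (L.get i).length) ≃ Fin N :=
    finSigmaFinEquiv.trans (finCongr hcard)
  have hφ : ∀ p, (φ p : ℕ) = S p.1 + p.2 := by
    intro p
    change (finSigmaFinEquiv p : ℕ) = _
    rw [finSigmaFinEquiv_apply]
    congr 1
    exact List.sum_length_take L p.1 p.1.2.le
  have hSle : ∀ i : ℕ, S i ≤ N := by
    intro i
    have h : (L.map List.length).sum
        = ((L.take i).map List.length).sum + ((L.drop i).map List.length).sum := by
      rw [← List.sum_append, ← List.map_append, List.take_append_drop]
    simp only [S, hN, List.length_flatten, h]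
    omega
  have hSlt : ∀ (e : Fin L.length) (v : Fin ((L.get e).length + 1)), S e + v < N + 1 := by
    intro e v
    have h1 := hSle (e + 1)
    have h2 := hSs e
    omega
  let a : (pathGraph l hl).V → Fin (N + 1) :=
    fun j : Fin (L.length + 1) => ⟨S j, Nat.lt_succ_of_le (hSle j)⟩
  let b : ∀ e : Fin L.length, (σ e).V → Fin (N + 1) :=
    fun e (v : Fin ((L.get e).length + 1)) => ⟨S e + v, hSlt e v⟩
  have hab : ∀ (e : (pathGraph l hl).E) (i : ℕ) (x : (pathGraph l hl).V) (v : (σ e).V),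
      ((pathGraph l hl).att e)[i]? = some x → (σ e).extNodes[i]? = some v → b e v = a x := by
    intro e i x v hx hv
    change Fin L.length at e
    change Fin (L.length + 1) at x
    change Fin ((L.get e).length + 1) at v
    change ([e.castSucc, e.succ] : List (Fin (L.length + 1)))[i]? = some x at hx
    change ([0, Fin.last _] : List (Fin ((L.get e).length + 1)))[i]? = some v at hv
    match i with
    | 0 =>
      simp only [List.getElem?_cons_zero, Option.some.injEq] at hx hv
      subst hx hv
      simp [a, b]
    | 1 =>
      simp only [List.getElem?_cons_succ, List.getElem?_cons_zero, Option.some.injEq] at hx hv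
      subst hx hv
      apply Fin.ext
      exact (hSs e).symm
    | i + 2 => simp at hx
  let f : ((pathGraph l hl).replace σ).V → Fin (N + 1) := replaceDesc a b hab
  -- Injectivity of `f` on the quotient is proved through representatives: the initial node, and the
  -- target node of each inner hyperedge. These exhaust the quotient, and `f` separates them.
  let g : Option ((i : Fin L.length) × Fin (L.get i).length) → ((pathGraph l hl).replace σ).V :=
    fun o => o.elim (outerNode (pathGraph l hl) σ (0 : Fin (L.length + 1)))
      fun p => innerNode (pathGraph l hl) σ p.1 p.2.succ
  have hfg : ∀ p, f (g (some p)) = (φ p).succ := by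
    intro p
    apply Fin.ext
    rw [Fin.val_succ, hφ]
    rfl
  have hf0 : f (g none) = 0 := Fin.ext hS0
  have hinner : ∀ (e : Fin L.length) (v : Fin ((L.get e).length + 1)),
      (∃ o, g o = outerNode (pathGraph l hl) σ e.castSucc) →
        ∃ o, g o = innerNode (pathGraph l hl) σ e v := by
    intro e v h
    induction v using Fin.cases with
    | zero =>
      obtain ⟨o, ho⟩ := h
      exact ⟨o, ho.trans (innerNode_eq_outerNode (H := pathGraph l hl) (i := 0) rfl rfl).symm⟩
    | succ v => exact ⟨some ⟨e, v⟩, rfl⟩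
  have houter : ∀ j : Fin (L.length + 1), ∃ o, g o = outerNode (pathGraph l hl) σ j := by
    intro j
    induction j using Fin.induction with
    | zero => exact ⟨none, rfl⟩
    | succ j ih =>
      obtain ⟨o, ho⟩ := hinner j (Fin.last _) ih
      exact ⟨o, ho.trans (innerNode_eq_outerNode (H := pathGraph l hl) (i := 1) rfl rfl)⟩
  have hg : Function.Surjective g :=
    replace_node_induction houter fun e v => hinner e v (houter _)
  have hf : Function.Bijective f := by
    constructor
    · intro p q hpq
      obtain ⟨o, rfl⟩ := hg p
      obtain ⟨o', rfl⟩ := hg q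
      cases o <;> cases o'
      · rfl
      · rw [hfg, hf0] at hpq
        exact absurd hpq.symm (Fin.succ_ne_zero _)
      · rw [hfg, hf0] at hpq
        exact absurd hpq (Fin.succ_ne_zero _)
      · rw [hfg, hfg, Fin.succ_inj, φ.apply_eq_iff_eq] at hpq
        rw [hpq]
    · intro k
      induction k using Fin.cases with
      | zero => exact ⟨_, hf0⟩
      | succ k => exact ⟨g (some (φ.symm k)), by rw [hfg, Equiv.apply_symm_apply]⟩
  refine ⟨hw, Equiv.ofBijective f hf, φ, ?_, ?_, ?_⟩
  · rintro ⟨i, j⟩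
    change [(φ ⟨i, j⟩).castSucc, (φ ⟨i, j⟩).succ] = [b i j.castSucc, b i j.succ]
    have h1 : (φ ⟨i, j⟩).castSucc = b i j.castSucc := Fin.ext (hφ _)
    have h2 : (φ ⟨i, j⟩).succ = b i j.succ := (hfg ⟨i, j⟩).symm
    rw [h1, h2]
  · rintro ⟨i, j⟩
    change L.flatten.get (φ ⟨i, j⟩) = (L.get i).get j
    have := List.flatten_getElem?_take L i.2 j.2
    rw [← hφ ⟨i, j⟩] at this
    exact (List.getElem?_eq_some_iff.1 this).2
  · change [0, Fin.last N] = [a (0 : Fin (L.length + 1)), a (Fin.last L.length)]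
    have h1 : a (0 : Fin (L.length + 1)) = 0 := Fin.ext hS0
    have h2 : a (Fin.last L.length) = Fin.last N := Fin.ext hSN
    rw [h1, h2]

/-- Replacing the hyperedges of a hypergraph shaped like a string graph by string graphs
concatenates the strings. -/
theorem replace_represents {H : HRHypergraph ty} {σ : H.E → HRHypergraph ty} (L : List (List Λ))
    (gV : H.V ≃ Fin (L.length + 1)) (gE : H.E ≃ Fin L.length)
    (ha : ∀ e, (H.att e).map gV = [(gE e).castSucc, (gE e).succ])
    (hx : H.extNodes.map gV = [0, Fin.last L.length])
    (hσ : ∀ e, (σ e).Represents (L.get (gE e))) : (H.replace σ).Represents L.flatten := by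
  have hl : ∀ i, ty (H.lab (gE.symm i)) = 2 := by
    intro i
    rw [← H.att_length, ← List.length_map (f := gV), ha]
    rfl
  have hL : ∀ i, ∀ x ∈ L.get i, ty x = 2 := by
    intro i
    have := (hσ (gE.symm i)).choose
    rwa [Equiv.apply_symm_apply] at this
  refine Represents.of_iso ?_ (pathGraph_replace_represents L (fun i => H.lab (gE.symm i)) hl hL)
  exact replace_congr gV gE (fun e => (ha e).symm) hx.symm fun e => (hσ e).choose_spec

theorem replace_represents_ofFn {H : HRHypergraph ty} {σ : H.E → HRHypergraph ty} {n : ℕ}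
    (u : Fin n → List Λ) (gV : H.V ≃ Fin (n + 1)) (gE : H.E ≃ Fin n)
    (ha : ∀ e, (H.att e).map gV = [(gE e).castSucc, (gE e).succ])
    (hx : H.extNodes.map gV = [0, Fin.last n])
    (hσ : ∀ e, (σ e).Represents (u (gE e))) : (H.replace σ).Represents (List.ofFn u).flatten := by
  have key : ∀ (L : List (List Λ)) (h : L.length = n), (∀ i, L.get (i.cast h.symm) = u i) →
      (H.replace σ).Represents L.flatten := by
    intro L h hL
    subst h
    exact replace_represents L gV gE ha hx fun e => (hL (gE e)).symm ▸ hσ e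
  exact key _ List.length_ofFn fun i => by simp

end HRHypergraph

/-! ### Context-freeness: derivations split at the first step. -/

namespace PHRTable

open HRHypergraph

variable {Λ : Type u} {ty : Λ → ℕ}

/-- The hypergraphs derived from the handle of a label by a sequence of tables, decomposed at the
first derivation step. -/
def Gen : List (PHRTable ty) → Λ → HRHypergraph ty → Prop
  | [], X, G => G.Iso (handle ty X)
  | T :: ts, X, G => ∃ R, (X, R) ∈ T.rules ∧ ∃ τ : R.E → HRHypergraph ty,
      (∀ e, Gen ts (R.lab e) (τ e)) ∧ G.Iso (R.replace τ)

theorem Gen.of_iso {ts : List (PHRTable ty)} {X : Λ} {G G' : HRHypergraph ty} (h : Gen ts X G)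
    (i : G'.Iso G) : Gen ts X G' := by
  cases ts with
  | nil => exact i.trans h
  | cons T ts =>
    obtain ⟨R, hR, τ, hτ, hG⟩ := h
    exact ⟨R, hR, τ, hτ, i.trans hG⟩

theorem handle_arity (X : Λ) : (handle ty X).arity = ty X := by simp [handle, arity]

theorem replace_arity (H : HRHypergraph ty) (σ : H.E → HRHypergraph ty) :
    (H.replace σ).arity = H.arity := by
  simp [arity, replace_extNodes]

theorem Gen.arity_eq {ts : List (PHRTable ty)} {X : Λ} {G : HRHypergraph ty} (h : Gen ts X G) :
    G.arity = ty X := by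
  cases ts with
  | nil => rw [Iso.arity_eq h, handle_arity]
  | cons T ts =>
    obtain ⟨R, hR, τ, hτ, hG⟩ := h
    rw [hG.arity_eq, replace_arity]
    exact T.arity_eq _ hR

theorem Gen.cons_handle {T : PHRTable ty} {ts : List (PHRTable ty)} {X Y : Λ}
    {G : HRHypergraph ty} (hT : (X, handle ty Y) ∈ T.rules) (h : Gen ts Y G) :
    Gen (T :: ts) X G :=
  ⟨_, hT, fun _ => G, fun _ => h, (handle_replace Y (fun _ => G) h.arity_eq).symm⟩

theorem gen_handle_elim {ts : List (PHRTable ty)} {Y : Λ} {G : HRHypergraph ty}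
    {τ : (handle ty Y).E → HRHypergraph ty} (hτ : ∀ e, Gen ts ((handle ty Y).lab e) (τ e))
    (hG : G.Iso ((handle ty Y).replace τ)) : Gen ts Y G :=
  Gen.of_iso (hτ ()) (hG.trans (handle_replace Y τ (hτ ()).arity_eq))

/-- Together with `Gen.exists_step`, this matches the first-step decomposition with derivations
extended at the end; associativity of replacement moves the last step inside the first. -/
theorem Gen.step {ts : List (PHRTable ty)} {T : PHRTable ty} {X : Λ} {G G' : HRHypergraph ty}
    (h : Gen ts X G) (hs : T.Step G G') : Gen (ts ++ [T]) X G' := by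
  induction ts generalizing X G G' with
  | nil =>
    obtain ⟨σ, hσ, i⟩ := hs
    obtain ⟨gV, gE, ha, hl, hx⟩ := Iso.symm h
    have hm : (X, σ (gE ())) ∈ T.rules :=
      (congrArg (fun Y => (Y, σ (gE ())) ∈ T.rules) (hl ())).mp (hσ _)
    refine ⟨_, hm, _, fun e => Iso.refl _, Iso.trans (i.trans ?_) (replace_handle _).symm⟩
    refine Iso.trans (Iso.symm ?_) (handle_replace X (fun e => σ (gE e)) (T.arity_eq _ hm))
    exact replace_congr gV gE ha hx fun e => Iso.refl _
  | cons T' ts ih =>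
    obtain ⟨R, hR, τ, hτ, i⟩ := h
    obtain ⟨σ, hσ, i'⟩ := hs
    obtain ⟨gV, gE, ha, hl, hx⟩ := i.symm
    refine ⟨R, hR, fun e => (τ e).replace fun e' => σ (gE ⟨e, e'⟩), fun e => ?_, ?_⟩
    · refine ih (hτ e) ⟨_, fun e' => ?_, Iso.refl _⟩
      exact (congrArg (fun Y => (Y, σ (gE ⟨e, e'⟩)) ∈ T.rules) (hl ⟨e, e'⟩)).mp (hσ _)
    · refine (i'.trans (Iso.symm ?_)).trans (replace_assoc R τ fun p => σ (gE p))
      exact replace_congr gV gE ha hx fun e => Iso.refl _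

theorem Gen.exists_step {ts : List (PHRTable ty)} {T : PHRTable ty} {X : Λ} {G : HRHypergraph ty}
    (h : Gen (ts ++ [T]) X G) : ∃ H, Gen ts X H ∧ T.Step H G := by
  induction ts generalizing X G with
  | nil =>
    obtain ⟨R, hR, τ, hτ, i⟩ := h
    refine ⟨handle ty X, Iso.refl _, fun _ => R, fun _ => hR, i.trans ?_⟩
    refine ((replace_congr_right hτ).trans (replace_handle R)).trans ?_
    exact (handle_replace X (fun _ => R) (T.arity_eq _ hR)).symm
  | cons T' ts ih =>
    obtain ⟨R, hR, τ, hτ, i⟩ := h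
    choose H hH σ hσ hi using fun e => ih (hτ e)
    refine ⟨R.replace H, ⟨R, hR, H, hH, Iso.refl _⟩, fun p => σ p.1 p.2, fun p => hσ p.1 p.2, ?_⟩
    refine i.trans ((replace_congr_right hi).trans ?_)
    exact (replace_assoc R H fun p => σ p.1 p.2).symm

end PHRTable

namespace PHRGrammar

open HRHypergraph PHRTable

variable {Λ : Type u} {ty : Λ → ℕ}

theorem derives_handle_iff (G : PHRGrammar ty) (X : Λ) (H : HRHypergraph ty) :
    G.Derives (handle ty X) H ↔ ∃ ts : List (PHRTable ty), (∀ T ∈ ts, T ∈ G.tables) ∧ Gen ts X H := by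
  constructor
  · rintro (h | h)
    · exact ⟨[], by simp, h.symm⟩
    · induction h with
      | single h =>
        obtain ⟨T, hT, hs⟩ := h
        exact ⟨[T], by simpa using hT, Gen.step (ts := []) (Iso.refl _) hs⟩
      | tail _ h ih =>
        obtain ⟨T, hT, hs⟩ := h
        obtain ⟨ts, hts, hg⟩ := ih
        refine ⟨ts ++ [T], fun T' h' => ?_, hg.step hs⟩
        rcases List.mem_append.1 h' with h' | h'
        · exact hts T' h'
        · rwa [List.mem_singleton.1 h']
  · rintro ⟨ts, hts, hg⟩
    induction ts using List.reverseRecOn generalizing H with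
    | nil => exact Or.inl (Iso.symm hg)
    | append_singleton ts T ih =>
      obtain ⟨K, hK, hs⟩ := hg.exists_step
      have hT : T ∈ G.tables := hts T (by simp)
      rcases ih K (fun T' h' => hts T' (by simp [h'])) hK with h | h
      · refine Or.inr (.single ⟨T, hT, ?_⟩)
        obtain ⟨σ, hσ, i⟩ := hs
        obtain ⟨gV, gE, ha, hl, hx⟩ := h
        refine ⟨fun e => σ (gE e), fun e => hl e ▸ hσ (gE e), i.trans (Iso.symm ?_)⟩
        exact replace_congr gV gE ha hx fun e => Iso.refl _
      · exact Or.inr (.tail h ⟨T, hT, hs⟩)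

theorem mem_language_iff (G : PHRGrammar ty) (H : HRHypergraph ty) :
    H ∈ G.language ↔ (∃ ts : List (PHRTable ty), (∀ T ∈ ts, T ∈ G.tables) ∧ Gen ts G.start H) ∧
      ∀ e, H.lab e ∈ G.terminals := by
  rw [← derives_handle_iff]
  rfl

end PHRGrammar

/-! ### Algebra of substitutions. -/

section Substitution

variable {α : Type u}

/-- The composite of a sequence of substitutions. -/
def substComp : List (α → Language α) → α → Language α
  | [], a => {[a]}
  | h :: hs, a => substImage (substComp hs) (h a)

theorem mem_substImage_iff {h : α → Language α} {L : Language α} {w : List α} :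
    w ∈ substImage h L ↔ ∃ x ∈ L, w ∈ (x.map h).prod := by
  have key : ∀ (x w : List α), (∃ ws : List (List α), List.Forall₂ (fun a v => v ∈ h a) x ws ∧
      w = ws.flatten) ↔ w ∈ (x.map h).prod := by
    intro x
    induction x with
    | nil =>
      intro w
      simp [Language.mem_one]
    | cons a x ih =>
      intro w
      rw [List.map_cons, List.prod_cons, Language.mem_mul]
      constructor
      · rintro ⟨_, h', rfl⟩
        cases h' with
        | cons h1 h2 => exact ⟨_, h1, _, (ih _).1 ⟨_, h2, rfl⟩, rfl⟩
      · rintro ⟨v, hv, v', hv', rfl⟩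
        obtain ⟨ws, h1, rfl⟩ := (ih _).2 hv'
        exact ⟨v :: ws, .cons hv h1, rfl⟩
  simp only [← key]
  rfl

theorem substImage_mul (h : α → Language α) (K L : Language α) :
    substImage h (K * L) = substImage h K * substImage h L := by
  ext w
  simp only [mem_substImage_iff, Language.mem_mul]
  constructor
  · rintro ⟨_, ⟨x, hx, y, hy, rfl⟩, hw⟩
    rw [List.map_append, List.prod_append, Language.mem_mul] at hw
    obtain ⟨v, hv, v', hv', rfl⟩ := hw
    exact ⟨v, ⟨x, hx, hv⟩, v', ⟨y, hy, hv'⟩, rfl⟩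
  · rintro ⟨v, ⟨x, hx, hv⟩, v', ⟨y, hy, hv'⟩, rfl⟩
    refine ⟨x ++ y, ⟨x, hx, y, hy, rfl⟩, ?_⟩
    rw [List.map_append, List.prod_append, Language.mem_mul]
    exact ⟨v, hv, v', hv', rfl⟩

theorem mem_substImage_prod {g h : α → Language α} {x w : List α} :
    w ∈ substImage g (x.map h).prod ↔ w ∈ (x.map fun a => substImage g (h a)).prod := by
  induction x generalizing w with
  | nil =>
    rw [mem_substImage_iff]
    simp [Language.mem_one]
  | cons a x ih => simp only [List.map_cons, List.prod_cons, substImage_mul, Language.mem_mul, ih]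

/-- Substitution respects concatenation, so composing can be done letter by letter. Iterated images
thereby reduce to the single substitution `substComp`. -/
theorem substImage_substImage (g h : α → Language α) (L : Language α) :
    substImage g (substImage h L) = substImage (fun a => substImage g (h a)) L := by
  ext w
  constructor
  · intro hw
    obtain ⟨y, hy, hw⟩ := mem_substImage_iff.1 hw
    obtain ⟨x, hx, hy⟩ := mem_substImage_iff.1 hy
    exact mem_substImage_iff.2 ⟨x, hx, mem_substImage_prod.1 (mem_substImage_iff.2 ⟨y, hy, hw⟩)⟩
  · intro hw
    obtain ⟨x, hx, hw⟩ := mem_substImage_iff.1 hw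
    obtain ⟨y, hy, hw⟩ := mem_substImage_iff.1 (mem_substImage_prod.2 hw)
    exact mem_substImage_iff.2 ⟨y, mem_substImage_iff.2 ⟨x, hx, hy⟩, hw⟩

theorem substImage_singleton_letter (L : Language α) :
    substImage (fun a => ({[a]} : Language α)) L = L := by
  have key : ∀ x w : List α, w ∈ (x.map fun a => ({[a]} : Language α)).prod ↔ w = x := by
    intro x
    induction x with
    | nil => simp [Language.mem_one]
    | cons a x ih =>
      intro w
      rw [List.map_cons, List.prod_cons, Language.mem_mul]
      constructor
      · rintro ⟨v, rfl, v', hv', rfl⟩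
        rw [(ih _).1 hv']
        rfl
      · rintro rfl
        exact ⟨[a], rfl, x, (ih _).2 rfl, rfl⟩
  ext w
  simp [mem_substImage_iff, key]

theorem foldl_substImage (hs : List (α → Language α)) (L : Language α) :
    hs.foldl (fun K h => substImage h K) L = substImage (substComp hs) L := by
  induction hs generalizing L with
  | nil => exact (substImage_singleton_letter L).symm
  | cons h hs ih => exact (ih _).trans (substImage_substImage _ _ _)

theorem flatten_mem_substImage {h : α → Language α} {L : Language α} {x : List α} (hx : x ∈ L)
    (ws : List (List α)) (hlen : x.length = ws.length)
    (hws : ∀ i (h1 : i < x.length) (h2 : i < ws.length), ws[i] ∈ h x[i]) :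
    ws.flatten ∈ substImage h L :=
  ⟨x, hx, ws, List.forall₂_iff_get.2 ⟨hlen, hws⟩, rfl⟩

end Substitution

/-! ### The grammar for the iterated substitution. -/

open HRHypergraph PHRTable

/-- A parallel hyperedge replacement grammar together with an alphabet embedded in its labels. -/
structure Presentation (α : Type u) where
  Label : Type u
  finite : Finite Label
  ty : Label → ℕ
  emb : α ↪ Label
  grammar : PHRGrammar ty

/-- The grammar generates string graphs only, representing the non-empty strings of `L`. -/
def Presentation.Generates {α : Type u} (P : Presentation α) (L : Language α) : Prop :=
  P.grammar.GeneratesStringGraphs ∧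
    P.grammar.strings = {w | ∃ u ∈ L, u ≠ [] ∧ u.map P.emb = w}

namespace IterGrammar

variable {α J : Type u}

/-- The labels of the grammar for the iterated substitution: letters of the final string, letters of
an intermediate string, requests for a string of one of the given languages, labels of one of the
given grammars, and a label that is never removed. The Boolean flags record that a nonempty
string has to be derived. -/
inductive IterLabel (P : Option (J × α) → Presentation α) : Type u
  | final (a : α)
  | done (a : α) (m : Bool)
  | wait (i : Option (J × α)) (m : Bool)
  | act (i : Option (J × α)) (X : (P i).Label) (m : Bool)
  | dead

/-- The names of the tables: a table of one of the given grammars, the passage from strings of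
the given grammars to intermediate strings, the beginning of a substitution, and the passage to
final strings. -/
inductive IterCode (P : Option (J × α) → Presentation α) : Type (max u 1)
  | run (i : Option (J × α)) (t : (P i).grammar.tables)
  | finish
  | round (j : J)
  | final

variable {P : Option (J × α) → Presentation α}

/-- The type of a label. -/
def IterLabel.ty : IterLabel P → ℕ
  | .final _ => 2
  | .done _ _ => 2
  | .wait _ _ => 2
  | .act i X _ => (P i).ty X
  | .dead => 0

/-- The tables under which requests and intermediate letters may persist. -/
def IterCode.Neutral : IterCode P → Prop
  | .run _ _ => True
  | .finish => True
  | .round _ => False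
  | .final => False

/-- A hypergraph of type `n` with a single hyperedge, labelled by `dead`. -/
def failGraph (P : Option (J × α) → Presentation α) (n : ℕ) :
    HRHypergraph (IterLabel.ty (P := P)) where
  V := Fin n
  E := Unit
  finiteV := inferInstance
  finiteE := inferInstance
  att := fun _ => []
  lab := fun _ => .dead
  extNodes := List.finRange n
  att_length := fun _ => rfl

/-- A hypergraph over one of the given signatures, with flags on its hyperedges. -/
def flag {i : Option (J × α)} (R : HRHypergraph (P i).ty) (μ : R.E → Bool) :
    HRHypergraph (IterLabel.ty (P := P)) :=
  R.relabel (fun e => .act i (R.lab e) (μ e)) fun _ => rfl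

/-- The rules of the tables. -/
inductive IterRule (s : J → α → Language α) :
    IterCode P → IterLabel P → HRHypergraph (IterLabel.ty (P := P)) → Prop
  -- Makes every table total. It is the only rule for `dead` and for `final` letters, so failure is
  -- permanent and the passage to final letters must be the last step.
  | fail (c X) : IterRule s c X (failGraph P X.ty)
  | keepDone (c) (hc : c.Neutral) (a m) : IterRule s c (.done a m) (handle _ (.done a m))
  | keepWait (c) (hc : c.Neutral) (i m) : IterRule s c (.wait i m) (handle _ (.wait i m))
  -- The type condition keeps the rule well typed and loses nothing: a start label of another type
  -- derives no string graph.
  | activate (c) (hc : c.Neutral) (i m) (h : (P i).ty (P i).grammar.start = 2) :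
      IterRule s c (.wait i m) (handle _ (.act i (P i).grammar.start m))
  | erase (c) (hc : c.Neutral) (j a) (h : [] ∈ s j a) :
      IterRule s c (.wait (some (j, a)) false) (stringGraph _ [] (by simp))
  -- The flag is the disjunction of the successors' flags: an obligation is passed on to at least
  -- one hyperedge and never created.
  | run (i t X R) (h : (X, R) ∈ t.1.rules) (μ : R.E → Bool) (m : Bool)
      (hm : m = true ↔ ∃ e, μ e = true) : IterRule s (.run i t) (.act i X m) (flag R μ)
  | finish (i a m) (h : (P i).emb a ∈ (P i).grammar.terminals) (h2 : (P i).ty ((P i).emb a) = 2) :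
      IterRule s .finish (.act i ((P i).emb a) m) (handle _ (.done a m))
  | round (j a m) : IterRule s (.round j) (.done a m) (handle _ (.wait (some (j, a)) m))
  | final (a m) : IterRule s .final (.done a m) (handle _ (.final a))

theorem IterRule.arity_eq {s : J → α → Language α} {c : IterCode P} {X : IterLabel P}
    {R : HRHypergraph (IterLabel.ty (P := P))} (h : IterRule s c X R) : R.arity = X.ty := by
  cases h with
  | fail => simp [failGraph, arity]
  | activate c hc i m h => rw [handle_arity]; exact h
  | erase => rfl
  | run i t X R h μ m hm => exact t.1.arity_eq _ h
  | finish i a m h h2 => rw [handle_arity]; exact h2.symm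
  | _ => rw [handle_arity]; try rfl

instance finite_iterLabel [Finite α] [Finite J] : Finite (IterLabel P) := by
  have : ∀ i, Finite (P i).Label := fun i => (P i).finite
  refine Finite.of_surjective (α := α ⊕ (α × Bool) ⊕ (Option (J × α) × Bool) ⊕
    ((i : Option (J × α)) × (P i).Label) × Bool ⊕ Unit) (Sum.elim .final (Sum.elim
      (fun p => .done p.1 p.2) (Sum.elim (fun p => .wait p.1 p.2) (Sum.elim
      (fun p => .act p.1.1 p.1.2 p.2) fun _ => .dead)))) ?_
  rintro (a | ⟨a, m⟩ | ⟨i, m⟩ | ⟨i, X, m⟩ | _)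
  exacts [⟨.inl a, rfl⟩, ⟨.inr (.inl (a, m)), rfl⟩, ⟨.inr (.inr (.inl (i, m))), rfl⟩,
    ⟨.inr (.inr (.inr (.inl (⟨i, X⟩, m)))), rfl⟩, ⟨.inr (.inr (.inr (.inr ()))), rfl⟩]

instance finite_iterCode [Finite α] [Finite J] : Finite (IterCode P) := by
  have : ∀ i, Finite (P i).grammar.tables := fun i => (P i).grammar.finite_tables.to_subtype
  refine Finite.of_surjective (α := ((i : Option (J × α)) × (P i).grammar.tables) ⊕ J ⊕ Bool)
    (Sum.elim (fun p => .run p.1 p.2) (Sum.elim .round fun b => if b then .finish else .final)) ?_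
  rintro (⟨i, t⟩ | _ | j | _)
  exacts [⟨.inl ⟨i, t⟩, rfl⟩, ⟨.inr (.inr true), rfl⟩, ⟨.inr (.inl j), rfl⟩,
    ⟨.inr (.inr false), rfl⟩]

theorem finite_iterRule [Finite α] [Finite J] (s : J → α → Language α) (c : IterCode P) :
    {p : IterLabel P × HRHypergraph (IterLabel.ty (P := P)) | IterRule s c p.1 p.2}.Finite := by
  have h1 := Set.finite_range fun X : IterLabel P => (X, failGraph P X.ty)
  have h2 := Set.finite_range fun p : IterLabel P × IterLabel P =>
    (p.1, handle (IterLabel.ty (P := P)) p.2)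
  have h3 := Set.finite_range fun X : IterLabel P =>
    (X, stringGraph (IterLabel.ty (P := P)) [] (by simp))
  have h4 : ∀ (i : Option (J × α)) (t : (P i).grammar.tables),
      (⋃ p ∈ t.1.rules, Set.range fun q : (p.2.E → Bool) × Bool =>
        ((.act i p.1 q.2 : IterLabel P), flag p.2 q.1)).Finite := by
    intro i t
    refine t.1.finite_rules.biUnion fun p _ => ?_
    have := p.2.finiteE
    exact Set.finite_range _
  have h5 : (⋃ p : (i : Option (J × α)) × (P i).grammar.tables,
      (⋃ r ∈ p.2.1.rules, Set.range fun q : (r.2.E → Bool) × Bool =>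
        ((.act p.1 r.1 q.2 : IterLabel P), flag r.2 q.1))).Finite := by
    have : ∀ i, Finite (P i).grammar.tables := fun i => (P i).grammar.finite_tables.to_subtype
    exact Set.finite_iUnion fun p => h4 p.1 p.2
  refine (((h1.union h2).union h3).union h5).subset ?_
  rintro ⟨X, R⟩ h
  change IterRule s c X R at h
  cases h with
  | fail => exact .inl (.inl (.inl ⟨X, rfl⟩))
  | erase => exact .inl (.inr ⟨_, rfl⟩)
  | run i t X R h μ m hm =>
    exact .inr (Set.mem_iUnion.2 ⟨⟨i, t⟩, Set.mem_biUnion h ⟨(μ, m), rfl⟩⟩)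
  | _ => exact .inl (.inl (.inr ⟨(_, _), rfl⟩))

section Finite

variable [Finite α] [Finite J] (s : J → α → Language α)

/-- The tables of the grammar for the iterated substitution. -/
def table (c : IterCode P) : PHRTable (IterLabel.ty (P := P)) where
  rules := {p | IterRule s c p.1 p.2}
  finite_rules := finite_iterRule s c
  arity_eq := fun _ h => IterRule.arity_eq h
  total := fun X => ⟨_, IterRule.fail c X⟩

/-- The grammar for the iterated substitution. -/
def grammar (P : Option (J × α) → Presentation α) : PHRGrammar (IterLabel.ty (P := P)) where
  terminals := Set.range .final
  start := .wait none true
  tables := Set.range (table s)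
  finite_tables := Set.finite_range _
  nonempty_tables := ⟨_, .finish, rfl⟩

theorem grammar_hasOrder {k : ℕ} (hk : 2 ≤ k) (hP : ∀ i, (P i).grammar.HasOrder k) :
    (grammar s P).HasOrder k := by
  rintro _ ⟨c, rfl⟩ ⟨X, R⟩ h
  rw [(table s c).arity_eq _ h]
  cases X with
  | act i X m =>
    -- Every label of a given grammar has a rule in some table, so its type is the type of a rule
    -- and is bounded by `k`.
    obtain ⟨T, hT⟩ := (P i).grammar.nonempty_tables
    obtain ⟨R, hR⟩ := T.total X
    exact (T.arity_eq _ hR).symm.le.trans (hP i T hT _ hR)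
  | dead => exact Nat.zero_le k
  | _ => exact hk

theorem grammar_repetitionFree (hP : ∀ i, (P i).grammar.RepetitionFree)
    (hs : ∀ j a, [] ∉ s j a) : (grammar s P).RepetitionFree := by
  rintro _ ⟨c, rfl⟩ ⟨X, R⟩ h
  change IterRule s c X R at h
  cases h with
  -- The string graph of the empty string lists its only node twice as external.
  | erase c hc j a h => exact absurd h (hs j a)
  | run i t X R h μ m hm => exact hP i t.1 t.2 _ h
  | _ => exact List.nodup_finRange _

/-- The derivations of the grammar for the iterated substitution, with named tables. -/
def CGen (cs : List (IterCode P)) (X : IterLabel P) (G : HRHypergraph (IterLabel.ty (P := P))) :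
    Prop :=
  Gen (cs.map (table s)) X G

theorem mem_grammar_language {G : HRHypergraph (IterLabel.ty (P := P))} :
    G ∈ (grammar s P).language ↔
      (∃ cs, CGen s cs (.wait none true) G) ∧ ∀ e, ∃ a, IterLabel.final a = G.lab e := by
  rw [PHRGrammar.mem_language_iff]
  refine and_congr ⟨?_, ?_⟩ Iff.rfl
  · rintro ⟨ts, hts, h⟩
    obtain ⟨cs, rfl⟩ : ts ∈ Set.range (List.map (table (P := P) s)) := by
      rw [Set.range_list_map]
      exact hts
    exact ⟨cs, h⟩
  · rintro ⟨cs, h⟩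
    refine ⟨cs.map (table s), fun T hT => ?_, h⟩
    obtain ⟨c, -, rfl⟩ := List.mem_map.1 hT
    exact ⟨c, rfl⟩

end Finite

end IterGrammar

/-! ### Soundness: every derived terminal hypergraph spells an iterated image. -/

namespace IterGrammar

variable {α J : Type u} {P : Option (J × α) → Presentation α}

/-- All labels are letters of the final string. -/
def IsFinal (G : HRHypergraph (IterLabel.ty (P := P))) : Prop :=
  ∀ e, ∃ a, IterLabel.final a = G.lab e

theorem IsFinal.of_iso {G G' : HRHypergraph (IterLabel.ty (P := P))} (h : IsFinal G)
    (i : G.Iso G') : IsFinal G' := by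
  obtain ⟨gV, gE, ha, hl, hx⟩ := i.symm
  intro e
  obtain ⟨a, ha⟩ := h (gE e)
  exact ⟨a, ha.trans (hl e)⟩

theorem IsFinal.of_replace {G R : HRHypergraph (IterLabel.ty (P := P))}
    {τ : R.E → HRHypergraph (IterLabel.ty (P := P))} (h : IsFinal G) (i : G.Iso (R.replace τ))
    (e : R.E) : IsFinal (τ e) :=
  fun e' => (h.of_iso i) ⟨e, e'⟩

/-- The string over `α` represented by a hypergraph. -/
def Spells (G : HRHypergraph (IterLabel.ty (P := P))) (u : List α) : Prop :=
  G.Represents (u.map .final)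

/-- The substitutions begun by a sequence of tables. -/
def rounds : List (IterCode P) → List J
  | [] => []
  | .round j :: cs => j :: rounds cs
  | .final :: _ => []
  | .run _ _ :: cs => rounds cs
  | .finish :: cs => rounds cs

theorem rounds_cons_neutral {c : IterCode P} (hc : c.Neutral) (cs : List (IterCode P)) :
    rounds (c :: cs) = rounds cs := by
  cases c with
  | run => rfl
  | finish => rfl
  | round => exact hc.elim
  | final => exact hc.elim

/-- The substitution performed by a sequence of tables. -/
def totalSubst (s : J → α → Language α) (cs : List (IterCode P)) : α → Language α :=
  substComp ((rounds cs).map s)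

theorem totalSubst_cons_neutral (s : J → α → Language α) {c : IterCode P} (hc : c.Neutral)
    (cs : List (IterCode P)) : totalSubst s (c :: cs) = totalSubst s cs := by
  rw [totalSubst, rounds_cons_neutral hc, totalSubst]

/-- `G` is obtained from the hypergraph `C` over one of the given signatures by replacing
hyperedges labelled by letters by images of these letters. -/
def Expands (σ : α → Language α) {i : Option (J × α)} (C : HRHypergraph (P i).ty) (m : Bool)
    (G : HRHypergraph (IterLabel.ty (P := P))) : Prop :=
  (∀ e, C.lab e ∈ (P i).grammar.terminals) ∧
    ∃ (τ : C.E → HRHypergraph (IterLabel.ty (P := P))) (a : C.E → α) (u : C.E → List α),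
      G.Iso ((flag C fun _ => true).replace τ) ∧
      (∀ e, C.lab e = (P i).emb (a e) ∧ u e ∈ σ (a e) ∧ Spells (τ e) (u e)) ∧
      (m = true → ∃ e, u e ≠ [])

/-- Lets the expansions of the individual successors be assembled after a `run` step; the flag
hypothesis supplies a successor that owes a nonempty string. -/
theorem Expands.replace {σ : α → Language α} {i : Option (J × α)} {R : HRHypergraph (P i).ty}
    {C : R.E → HRHypergraph (P i).ty} {μ : R.E → Bool} {m : Bool}
    {τ : R.E → HRHypergraph (IterLabel.ty (P := P))} {G : HRHypergraph (IterLabel.ty (P := P))}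
    (h : ∀ e, Expands σ (C e) (μ e) (τ e)) (hG : G.Iso ((flag R μ).replace τ))
    (hm : m = true → ∃ e, μ e = true) : Expands σ (R.replace C) m G := by
  choose hC τ' a u hi hau hne using h
  refine ⟨fun p => hC p.1 p.2, fun p => τ' p.1 p.2, fun p => a p.1 p.2, fun p => u p.1 p.2,
    ?_, fun p => hau p.1 p.2, ?_⟩
  · refine (hG.trans (replace_congr_right hi)).trans (Iso.symm ?_)
    exact relabel_replace R C (fun p => .act i ((R.replace C).lab p) true) (fun _ => rfl)
      (fun e => .act i (R.lab e) (μ e)) (fun _ => rfl) fun p => τ' p.1 p.2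
  · intro hm'
    obtain ⟨e, he⟩ := hm hm'
    obtain ⟨e', he'⟩ := hne e he
    exact ⟨⟨e, e'⟩, he'⟩

theorem Expands.handle {σ : α → Language α} {i : Option (J × α)} {a : α} {m : Bool}
    {G : HRHypergraph (IterLabel.ty (P := P))} {u : List α}
    (ht : (P i).emb a ∈ (P i).grammar.terminals) (hG : G.arity = (P i).ty ((P i).emb a))
    (hu : u ∈ σ a) (hs : Spells G u) (hm : m = true → u ≠ []) :
    Expands σ (handle (P i).ty ((P i).emb a)) m G := by
  refine ⟨fun _ => ht, fun _ => G, fun _ => a, fun _ => u, ?_, fun _ => ⟨rfl, hu, hs⟩,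
    fun h => ⟨(), hm h⟩⟩
  exact (handle_replace (ty := IterLabel.ty (P := P)) (.act i ((P i).emb a) true)
    (fun _ => G) hG).symm

/-- If `C` is a path reading `x`, the replaced hyperedges spell images of the letters of `x` in
order, so `G` spells their concatenation. -/
theorem Expands.of_represents {σ : α → Language α} {i : Option (J × α)}
    {C : HRHypergraph (P i).ty} {m : Bool} {G : HRHypergraph (IterLabel.ty (P := P))}
    (h : Expands σ C m G) {x : List α} (hx : C.Represents (x.map (P i).emb)) {L : Language α}
    (hL : x ∈ L) : ∃ u ∈ substImage σ L, Spells G u ∧ (m = true → u ≠ []) := by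
  obtain ⟨-, τ, a, u, hi, hau, hne⟩ := h
  obtain ⟨hw, gV, gE, ha, hl, hx⟩ := hx
  change C.V ≃ Fin ((x.map (P i).emb).length + 1) at gV
  change C.E ≃ Fin (x.map (P i).emb).length at gE
  refine ⟨(List.ofFn fun k => u (gE.symm k)).flatten,
    flatten_mem_substImage hL _ (by simp) fun k h1 h2 => ?_, ?_, ?_⟩
  · have h3 : k < (x.map (P i).emb).length := by simpa using h1
    have h4 : a (gE.symm ⟨k, h3⟩) = x[k] := by
      apply (P i).emb.injective
      rw [← (hau _).1, ← hl]
      change (x.map (P i).emb).get (gE _) = _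
      simp
    rw [← h4, List.getElem_ofFn]
    exact (hau _).2.1
  · rw [Spells, List.map_flatten, List.map_ofFn]
    refine Represents.of_iso hi (replace_represents_ofFn (H := flag C _) _ gV gE
      (fun e => (ha e).symm) hx.symm fun e => ?_)
    exact (congrArg (fun v : List α => (τ e).Represents (v.map .final))
      (congrArg u (gE.symm_apply_apply e))).mpr (hau e).2.2
  · intro hm hnil
    obtain ⟨e, he⟩ := hne hm
    exact he (List.flatten_eq_nil_iff.1 hnil _ ((List.mem_ofFn' _ _).2 ⟨gE e, by simp⟩))

theorem Spells.nil {G : HRHypergraph (IterLabel.ty (P := P))}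
    {τ : (stringGraph (IterLabel.ty (P := P)) [] (by simp)).E →
      HRHypergraph (IterLabel.ty (P := P))}
    (h : G.Iso ((stringGraph (IterLabel.ty (P := P)) [] (by simp)).replace τ)) : Spells G [] :=
  Represents.of_iso h (replace_represents [] (Equiv.refl _) (Equiv.refl _)
    (fun e => Fin.elim0 e) rfl fun e => Fin.elim0 e)

variable [Finite α] [Finite J] {s : J → α → Language α}

theorem CGen.of_iso {cs : List (IterCode P)} {X : IterLabel P}
    {G G' : HRHypergraph (IterLabel.ty (P := P))} (h : CGen s cs X G) (i : G'.Iso G) :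
    CGen s cs X G' := Gen.of_iso h i

theorem cGen_cons_iff {c : IterCode P} {cs : List (IterCode P)} {X : IterLabel P}
    {G : HRHypergraph (IterLabel.ty (P := P))} :
    CGen s (c :: cs) X G ↔ ∃ R, IterRule s c X R ∧
      ∃ τ : R.E → HRHypergraph (IterLabel.ty (P := P)),
        (∀ e, CGen s cs (R.lab e) (τ e)) ∧ G.Iso (R.replace τ) := Iff.rfl

theorem cGen_dead_not_isFinal {cs : List (IterCode P)} {G : HRHypergraph (IterLabel.ty (P := P))}
    (h : CGen s cs .dead G) : ¬ IsFinal G := by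
  induction cs generalizing G with
  | nil =>
    intro hf
    obtain ⟨a, ha⟩ := (hf.of_iso h) ()
    cases ha
  | cons c cs ih =>
    obtain ⟨R, hR, τ, hτ, i⟩ := cGen_cons_iff.1 h
    intro hf
    cases hR with
    | fail => exact ih (hτ ()) (hf.of_replace i ())

theorem cGen_final {cs : List (IterCode P)} {a : α} {G : HRHypergraph (IterLabel.ty (P := P))}
    (h : CGen s cs (.final a) G) (hf : IsFinal G) : Spells G [a] := by
  cases cs with
  | nil =>
    refine Represents.of_iso h ⟨?_, Equiv.refl (Fin 2), Equiv.ofUnique Unit (Fin 1), ?_, ?_, ?_⟩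
    · simp [IterLabel.ty]
    · rintro ⟨⟩
      rfl
    · rintro ⟨⟩
      rfl
    · rfl
  | cons c cs =>
    obtain ⟨R, hR, τ, hτ, i⟩ := cGen_cons_iff.1 h
    cases hR with
    | fail => exact absurd (hf.of_replace i ()) (cGen_dead_not_isFinal (hτ ()))

/-- Induction on the table sequence, for the three kinds of intermediate label at once. In the third
part `ts` is chosen before `X` and `G`: it is the maximal initial block of tables `run i t`, hence
common to all active hyperedges of index `i`. This uniformity is what makes the recovered `C` a
parallel derivation of `P i`. -/
theorem cGen_sound {K : Option (J × α) → Language α} (hP : ∀ i, (P i).Generates (K i))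
    (hK : ∀ j a, K (some (j, a)) = s j a) (cs : List (IterCode P)) :
    (∀ a m G, CGen s cs (.done a m) G → IsFinal G →
      ∃ u ∈ totalSubst s cs a, Spells G u ∧ (m = true → u ≠ [])) ∧
    (∀ i m G, CGen s cs (.wait i m) G → IsFinal G →
      ∃ u ∈ substImage (totalSubst s cs) (K i), Spells G u ∧ (m = true → u ≠ [])) ∧
    (∀ i, ∃ ts : List (PHRTable (P i).ty), (∀ T ∈ ts, T ∈ (P i).grammar.tables) ∧
      ∀ X m G, CGen s cs (.act i X m) G → IsFinal G →
        ∃ C, Gen ts X C ∧ Expands (totalSubst s cs) C m G) := by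
  induction cs with
  | nil =>
    refine ⟨fun a m G h hf => ?_, fun i m G h hf => ?_, fun i => ⟨[], by simp,
      fun X m G h hf => ?_⟩⟩
    all_goals
      obtain ⟨a, ha⟩ := (hf.of_iso h) ()
      cases ha
  | cons c cs ih =>
    obtain ⟨ihd, ihw, iha⟩ := ih
    refine ⟨fun a m G h hf => ?_, fun i m G h hf => ?_, fun i => ?_⟩
    · obtain ⟨R, hR, τ, hτ, hi⟩ := cGen_cons_iff.1 h
      cases hR with
      | fail => exact absurd (hf.of_replace hi ()) (cGen_dead_not_isFinal (hτ ()))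
      | keepDone _ hc =>
        rw [totalSubst_cons_neutral s hc]
        exact ihd a m G (gen_handle_elim hτ hi) hf
      | round j =>
        obtain ⟨u, hu, h⟩ := ihw _ m G (gen_handle_elim hτ hi) hf
        rw [hK] at hu
        exact ⟨u, hu, h⟩
      | final => exact ⟨[a], rfl, cGen_final (gen_handle_elim hτ hi) hf, by simp⟩
    · obtain ⟨R, hR, τ, hτ, hi⟩ := cGen_cons_iff.1 h
      cases hR with
      | fail => exact absurd (hf.of_replace hi ()) (cGen_dead_not_isFinal (hτ ()))
      | keepWait _ hc =>
        rw [totalSubst_cons_neutral s hc]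
        exact ihw i m G (gen_handle_elim hτ hi) hf
      | activate _ hc =>
        rw [totalSubst_cons_neutral s hc]
        obtain ⟨ts, hts, h⟩ := iha i
        obtain ⟨C, hC, hE⟩ := h _ m G (gen_handle_elim hτ hi) hf
        -- The given grammar generates only string graphs, so the shape of `C` is now known and its
        -- string lies in `K i`.
        have hlang : C ∈ (P i).grammar.language :=
          (PHRGrammar.mem_language_iff _ _).2 ⟨⟨ts, hts, hC⟩, hE.1⟩
        obtain ⟨w, hw⟩ := (hP i).1 C hlang
        have hw' : w ∈ (P i).grammar.strings := ⟨C, hlang, hw⟩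
        rw [(hP i).2] at hw'
        obtain ⟨x, hx, -, rfl⟩ := hw'
        exact hE.of_represents hw hx
      | erase _ hc j a hnil =>
        rw [totalSubst_cons_neutral s hc]
        exact ⟨[], ⟨[], (hK j a).symm ▸ hnil, [], .nil, rfl⟩, Spells.nil hi, by simp⟩
    · by_cases hci : ∃ t, c = .run i t
      · obtain ⟨t, rfl⟩ := hci
        obtain ⟨ts, hts, h'⟩ := iha i
        refine ⟨t.1 :: ts, by simpa using hts, fun X m G h hf => ?_⟩
        obtain ⟨R, hR, τ, hτ, hi⟩ := cGen_cons_iff.1 h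
        rw [totalSubst_cons_neutral s (c := .run i t) trivial]
        cases hR with
        | fail => exact absurd (hf.of_replace hi ()) (cGen_dead_not_isFinal (hτ ()))
        | run _ _ X R hR μ m hm =>
          choose C hC hE using fun e => h' _ _ _ (hτ e) (hf.of_replace hi e)
          exact ⟨R.replace C, ⟨R, hR, C, hC, Iso.refl _⟩, Expands.replace hE hi hm.1⟩
      -- The block of tables for `i` ends here; only `finish` lets an active label survive, and then
      -- it is already a letter.
      · refine ⟨[], by simp, fun X m G h hf => ?_⟩
        obtain ⟨R, hR, τ, hτ, hi⟩ := cGen_cons_iff.1 h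
        cases hR with
        | fail => exact absurd (hf.of_replace hi ()) (cGen_dead_not_isFinal (hτ ()))
        | run => exact absurd ⟨_, rfl⟩ hci
        | finish _ a m ht h2 =>
          rw [totalSubst_cons_neutral s (c := .finish) trivial]
          have hg := gen_handle_elim hτ hi
          obtain ⟨u, hu, hs, hm⟩ := ihd a m G hg hf
          exact ⟨_, Iso.refl _, Expands.handle ht (hg.arity_eq.trans h2.symm) hu hs hm⟩

end IterGrammar

/-! ### Completeness: scheduling the derivations. -/

namespace IterGrammar

variable {α J : Type u} {P : Option (J × α) → Presentation α}

theorem not_isEmpty_iff {u : List α} : (!u.isEmpty) = true ↔ u ≠ [] := by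
  cases u <;> simp

theorem mem_iter_iff {S : Set (α → Language α)} {L : Language α} {w : List α} :
    w ∈ ITER S L ↔ ∃ js : List S, w ∈ substImage (substComp (js.map Subtype.val)) L := by
  constructor
  · rintro ⟨hs, hS, hw⟩
    lift hs to List S using hS
    exact ⟨hs, foldl_substImage _ L ▸ hw⟩
  · rintro ⟨js, hw⟩
    refine ⟨js.map Subtype.val, fun h hh => ?_, (foldl_substImage _ L).symm ▸ hw⟩
    obtain ⟨j, -, rfl⟩ := List.mem_map.1 hh
    exact j.2

theorem isFinal_of_spells {G : HRHypergraph (IterLabel.ty (P := P))} {u : List α}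
    (h : Spells G u) : IsFinal G := by
  obtain ⟨hw, gV, gE, ha, hl, hx⟩ := h
  intro e
  obtain ⟨a, -, ha⟩ := List.mem_map.1 (List.get_mem (u.map (IterLabel.final (P := P))) (gE e))
  exact ⟨a, ha.trans (hl e)⟩

variable [Finite α] [Finite J] {s : J → α → Language α}

/-- A string is derived from a label by a sequence of tables. -/
def Yields (s : J → α → Language α) (cs : List (IterCode P)) (X : IterLabel P) (u : List α) :
    Prop :=
  ∃ G, CGen s cs X G ∧ Spells G u

theorem CGen.cons_handle {c : IterCode P} {cs : List (IterCode P)} {X Y : IterLabel P}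
    {G : HRHypergraph (IterLabel.ty (P := P))} (hc : IterRule s c X (handle _ Y))
    (h : CGen s cs Y G) : CGen s (c :: cs) X G :=
  Gen.cons_handle (T := table s c) hc h

theorem Yields.cons_handle {c : IterCode P} {cs : List (IterCode P)} {X Y : IterLabel P}
    {u : List α} (hc : IterRule s c X (handle _ Y)) (h : Yields s cs Y u) :
    Yields s (c :: cs) X u := by
  obtain ⟨G, hG, hu⟩ := h
  exact ⟨G, hG.cons_handle hc, hu⟩

theorem Yields.done_append {ns cs : List (IterCode P)} (hns : ∀ c ∈ ns, c.Neutral) {a : α}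
    {m : Bool} {u : List α} (h : Yields s cs (.done a m) u) :
    Yields s (ns ++ cs) (.done a m) u := by
  induction ns with
  | nil => exact h
  | cons c ns ih =>
    exact (ih fun c' hc' => hns c' (by simp [hc'])).cons_handle
      (.keepDone c (hns c (by simp)) a m)

theorem Yields.wait_append {ns cs : List (IterCode P)} (hns : ∀ c ∈ ns, c.Neutral)
    {i : Option (J × α)} {m : Bool} {u : List α} (h : Yields s cs (.wait i m) u) :
    Yields s (ns ++ cs) (.wait i m) u := by
  induction ns with
  | nil => exact h
  | cons c ns ih =>
    exact (ih fun c' hc' => hns c' (by simp [hc'])).cons_handle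
      (.keepWait c (hns c (by simp)) i m)

/-- A derivation of `P i` is replayed by `run` tables. The flags are prescribed on its result `C`
and computed backwards to the root. -/
theorem CGen.run {i : Option (J × α)} {ts : List (P i).grammar.tables} {X : (P i).Label}
    {C : HRHypergraph (P i).ty} (hC : Gen (ts.map Subtype.val) X C) {ν : C.E → Bool} {m : Bool}
    (hm : m = true ↔ ∃ e, ν e = true) {cs : List (IterCode P)}
    {τ : C.E → HRHypergraph (IterLabel.ty (P := P))}
    (hτ : ∀ e, CGen s cs (.act i (C.lab e) (ν e)) (τ e)) :
    CGen s (ts.map (.run i) ++ cs) (.act i X m) ((flag C ν).replace τ) := by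
  induction ts generalizing X C m with
  | nil =>
    obtain ⟨gV, gE, ha, hl, hx⟩ := hC
    have hν : ∀ e, ν e = m := by
      intro e
      rw [Bool.eq_iff_iff, hm]
      refine ⟨fun h => ⟨e, h⟩, fun ⟨e', h⟩ => ?_⟩
      have : e = e' := gE.injective (Subsingleton.elim (α := Unit) _ _)
      rwa [this]
    have h := hτ (gE.symm ())
    have hX : C.lab (gE.symm ()) = X := (hl _).symm
    rw [hν, hX] at h
    refine h.of_iso ?_
    refine Iso.trans ?_ (handle_replace (ty := IterLabel.ty (P := P)) (.act i X m)
      (fun e => τ (gE.symm e)) (Gen.arity_eq h))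
    refine replace_congr (H := flag C ν) gV gE ha hx fun e => ?_
    exact congrArg τ (gE.symm_apply_apply e) ▸ Iso.refl _
  | cons t ts ih =>
    obtain ⟨R, hR, ρ, hρ, gV, gE, ha, hl, hx⟩ := hC
    classical
    let ν' : (R.replace ρ).E → Bool := fun p => ν (gE.symm p)
    let τ' : (R.replace ρ).E → HRHypergraph (IterLabel.ty (P := P)) := fun p => τ (gE.symm p)
    -- A hyperedge is flagged exactly when some flagged hyperedge of the result descends from it.
    let μ : R.E → Bool := fun e => decide (∃ e', ν' ⟨e, e'⟩ = true)
    have hμ : ∀ e, μ e = true ↔ ∃ e', ν' ⟨e, e'⟩ = true := fun e => decide_eq_true_iff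
    have hmμ : m = true ↔ ∃ e, μ e = true := by
      simp only [hm, hμ]
      constructor
      · rintro ⟨e, he⟩
        refine ⟨(gE e).1, (gE e).2, ?_⟩
        change ν (gE.symm (gE e)) = true
        rwa [Equiv.symm_apply_apply]
      · rintro ⟨e, e', h⟩
        exact ⟨_, h⟩
    refine cGen_cons_iff.2 ⟨_, .run i t X R hR μ m hmμ,
      fun e => (flag (ρ e) fun e' => ν' ⟨e, e'⟩).replace fun e' => τ' ⟨e, e'⟩,
      fun e => ih (hρ e) (hμ e) fun e' => ?_, ?_⟩
    · have h := hτ (gE.symm ⟨e, e'⟩)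
      have hlab : C.lab (gE.symm ⟨e, e'⟩) = (ρ e).lab e' :=
        (hl _).symm.trans (congrArg (R.replace ρ).lab (gE.apply_symm_apply ⟨e, e'⟩))
      rwa [hlab] at h
    · refine Iso.trans ?_ (relabel_replace R ρ (fun p => .act i ((R.replace ρ).lab p) (ν' p))
        (fun _ => rfl) (fun e => .act i (R.lab e) (μ e)) (fun _ => rfl) τ')
      refine replace_congr (H := flag C ν) gV gE ha hx fun e => ?_
      exact congrArg τ (gE.symm_apply_apply e) ▸ Iso.refl _

variable {K : Option (J × α) → Language α}

/-- Serves one request by erasure or by replaying a derivation of its string `x`; all tables used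
are neutral, so other hyperedges can idle meanwhile. Erasure is available only for substitution
requests, hence the condition for `i = none`. -/
theorem exists_yields_wait (hP : ∀ i, (P i).Generates (K i))
    (hK : ∀ j a, K (some (j, a)) = s j a) {cs : List (IterCode P)} {i : Option (J × α)}
    {x : List α} (hx : x ∈ K i) (hi : i = none → x ≠ []) {ws : List (List α)}
    (hws : List.Forall₂ (fun a v => Yields s cs (.done a !v.isEmpty) v) x ws) :
    ∃ ns : List (IterCode P), (∀ c ∈ ns, c.Neutral) ∧
      Yields s (ns ++ cs) (.wait i !ws.flatten.isEmpty) ws.flatten := by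
  by_cases hnil : x = []
  · subst hnil
    cases hws
    rcases i with _ | ⟨j, a⟩
    · exact absurd rfl (hi rfl)
    · refine ⟨[.finish], by simp [IterCode.Neutral], _, cGen_cons_iff.2 ⟨_,
        .erase .finish trivial j a (hK j a ▸ hx), fun e => Fin.elim0 e, fun e => Fin.elim0 e,
        Iso.refl _⟩, Spells.nil (Iso.refl _)⟩
  · have hstr : x.map (P i).emb ∈ (P i).grammar.strings := by
      rw [(hP i).2]
      exact ⟨x, hx, hnil, rfl⟩
    obtain ⟨C, hC, hw, gV, gE, ha, hl, hext⟩ := hstr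
    obtain ⟨⟨ts, hts, hgen⟩, hterm⟩ := (PHRGrammar.mem_language_iff _ _).1 hC
    lift ts to List (P i).grammar.tables using hts
    change C.V ≃ Fin ((x.map (P i).emb).length + 1) at gV
    change C.E ≃ Fin (x.map (P i).emb).length at gE
    have hlen : (x.map (P i).emb).length = ws.length := by simpa using hws.length_eq
    have hlab : ∀ e, C.lab e = (P i).emb (x.get ((gE e).cast (by simp))) := by
      intro e
      rw [← hl]
      change (x.map (P i).emb).get (gE e) = _
      simp
    have hget : ∀ k : Fin (x.map (P i).emb).length, Yields s cs
        (.done (x.get (k.cast (by simp))) !(ws.get (k.cast hlen)).isEmpty) (ws.get (k.cast hlen)) :=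
      fun k => hws.get _ _
    choose τ hτ hspell using hget
    have hgenC : CGen s (ts.map (.run i) ++ .finish :: cs)
        (.act i (P i).grammar.start !ws.flatten.isEmpty)
        ((flag C fun e => !(ws.get ((gE e).cast hlen)).isEmpty).replace fun e => τ (gE e)) := by
      refine CGen.run hgen ?_ fun e => ?_
      · simp only [not_isEmpty_iff, Ne, List.flatten_eq_nil_iff, not_forall]
        constructor
        · rintro ⟨v, hv, hne⟩
          obtain ⟨k, rfl⟩ := List.mem_iff_get.1 hv
          exact ⟨gE.symm (k.cast hlen.symm), by simpa using hne⟩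
        · rintro ⟨e, he⟩
          exact ⟨_, List.get_mem _ _, he⟩
      · have ht := hterm e
        rw [hlab] at ht ⊢
        refine (hτ (gE e)).cons_handle (.finish i _ _ ht ?_)
        exact hw _ (List.mem_map_of_mem (List.get_mem _ _))
    have hstart : (P i).ty (P i).grammar.start = 2 := by
      rw [← hgen.arity_eq, arity, ← List.length_map (f := gV)]
      exact (congrArg List.length hext).symm
    -- The leading `finish` serves only as some neutral table under which to activate; the trailing
    -- one releases the letters.
    refine ⟨.finish :: (ts.map (.run i) ++ [.finish]), ?_,
      (flag C fun e => !(ws.get ((gE e).cast hlen)).isEmpty).replace fun e => τ (gE e), ?_, ?_⟩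
    · intro c hc
      simp only [List.mem_cons, List.mem_append, List.mem_map, List.not_mem_nil, or_false] at hc
      rcases hc with rfl | ⟨t, -, rfl⟩ | rfl <;> exact trivial
    · rw [List.cons_append, List.append_assoc]
      exact hgenC.cons_handle (.activate .finish trivial i _ hstart)
    · have hof : ws.flatten.map (IterLabel.final (P := P)) = (List.ofFn fun k =>
          (ws.get (Fin.cast hlen k)).map (IterLabel.final (P := P))).flatten := by
        rw [List.map_flatten]
        congr 1
        exact List.ext_getElem (by simp [hlen.symm]) fun n h1 h2 => by simp
      rw [Spells, hof]
      exact replace_represents_ofFn (H := flag C _) _ gV gE (fun e => (ha e).symm) hext.symm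
        fun e => hspell (gE e)

/-- Requests are served in separate consecutive blocks. Those not yet served persist as `wait`,
those already served as `done` letters, so equal requests may receive different strings. -/
theorem exists_yields_waits (hP : ∀ i, (P i).Generates (K i))
    (hK : ∀ j a, K (some (j, a)) = s j a) (cs : List (IterCode P))
    (F : List (Option (J × α) × List α × List (List α)))
    (hF : ∀ q ∈ F, q.2.1 ∈ K q.1 ∧ (q.1 = none → q.2.1 ≠ []) ∧
      List.Forall₂ (fun a v => Yields s cs (.done a !v.isEmpty) v) q.2.1 q.2.2) :
    ∃ ns : List (IterCode P), (∀ c ∈ ns, c.Neutral) ∧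
      ∀ q ∈ F, Yields s (ns ++ cs) (.wait q.1 !q.2.2.flatten.isEmpty) q.2.2.flatten := by
  induction F with
  | nil => exact ⟨[], by simp, by simp⟩
  | cons q F ih =>
    obtain ⟨ns, hns, h⟩ := ih fun q' hq' => hF q' (by simp [hq'])
    obtain ⟨h1, h2, h3⟩ := hF q (by simp)
    -- The letters produced by this first block must idle through the blocks `ns` of the others
    -- before `cs` acts on them.
    obtain ⟨ns', hns', h'⟩ := exists_yields_wait (cs := ns ++ cs) hP hK h1 h2
      (h3.imp fun a v hv => hv.done_append hns)
    refine ⟨ns' ++ ns, fun c hc => ?_, fun q' hq' => ?_⟩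
    · rcases List.mem_append.1 hc with hc | hc
      exacts [hns' c hc, hns c hc]
    · rw [List.append_assoc]
      rcases List.mem_cons.1 hq' with rfl | hq'
      · exact h'
      · exact (h q' hq').wait_append hns'

/-- All letters of a sentential form undergo the same tables, so the induction handles a whole list
of letters with target strings and yields one sequence for all. -/
theorem exists_yields_done (hP : ∀ i, (P i).Generates (K i))
    (hK : ∀ j a, K (some (j, a)) = s j a) (js : List J) (F : List (α × List α))
    (hF : ∀ p ∈ F, p.2 ∈ substComp (js.map s) p.1) :
    ∃ cs : List (IterCode P), ∀ p ∈ F, Yields s cs (.done p.1 !p.2.isEmpty) p.2 := by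
  induction js generalizing F with
  | nil =>
    refine ⟨[.final], fun p hp => ?_⟩
    have h : p.2 = [p.1] := hF p hp
    rw [h]
    refine ⟨_, CGen.cons_handle (.final _ _) (Iso.refl _ : CGen s [] (.final p.1) _),
      cGen_final (s := s) (cs := []) (Iso.refl _) fun _ => ⟨_, rfl⟩⟩
  | cons j js ih =>
    have hF' : ∀ p : {p // p ∈ F}, ∃ x ws, x ∈ s j p.1.1 ∧
        List.Forall₂ (fun a v => v ∈ substComp (js.map s) a) x ws ∧ p.1.2 = ws.flatten := by
      -- Split each target along the first substitution; the induction hypothesis is then applied to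
      -- all resulting letter-target pairs together.
      intro p
      obtain ⟨x, hx, ws, h1, h2⟩ := hF p.1 p.2
      exact ⟨x, ws, hx, h1, h2⟩
    choose x ws hx hws hflat using hF'
    obtain ⟨cs, hcs⟩ := ih (F.attach.flatMap fun p => (x p).zip (ws p)) (by
      intro q hq
      obtain ⟨p, -, hq⟩ := List.mem_flatMap.1 hq
      exact (List.forall₂_iff_zip.1 (hws p)).2 hq)
    obtain ⟨ns, hns, h⟩ := exists_yields_waits hP hK cs
      (F.attach.map fun p => (some (j, p.1.1), x p, ws p)) (by
        intro q hq
        obtain ⟨p, hp, rfl⟩ := List.mem_map.1 hq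
        refine ⟨(hK j _).symm ▸ hx p, by simp, List.forall₂_iff_zip.2
          ⟨(hws p).length_eq, fun {a v} hav => ?_⟩⟩
        exact hcs (a, v) (List.mem_flatMap.2 ⟨p, hp, hav⟩))
    refine ⟨.round j :: (ns ++ cs), fun p hp => ?_⟩
    have := h _ (List.mem_map.2 ⟨⟨p, hp⟩, List.mem_attach _ _, rfl⟩)
    simp only [← hflat] at this
    exact this.cons_handle (.round j _ _)

theorem exists_yields_start (hP : ∀ i, (P i).Generates (K i))
    (hK : ∀ j a, K (some (j, a)) = s j a) (js : List J) {u : List α} (hne : u ≠ [])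
    (hu : u ∈ substImage (substComp (js.map s)) (K none)) :
    ∃ cs : List (IterCode P), Yields s cs (.wait none true) u := by
  obtain ⟨x, hx, ws, h1, rfl⟩ := hu
  obtain ⟨cs, hcs⟩ := exists_yields_done hP hK js (x.zip ws) fun q hq =>
    (List.forall₂_iff_zip.1 h1).2 hq
  obtain ⟨ns, hns, h⟩ := exists_yields_wait (cs := cs) (i := none) (ws := ws) hP hK hx
    (by
      rintro - rfl
      cases h1
      exact hne rfl)
    (List.forall₂_iff_zip.2 ⟨h1.length_eq, fun {a v} hav => hcs (a, v) hav⟩)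
  rw [not_isEmpty_iff.2 hne] at h
  exact ⟨_, h⟩

theorem exists_spells_of_mem_language (hP : ∀ i, (P i).Generates (K i))
    (hK : ∀ j a, K (some (j, a)) = s j a) {G : HRHypergraph (IterLabel.ty (P := P))}
    (hG : G ∈ (grammar s P).language) :
    ∃ js : List J, ∃ u ∈ substImage (substComp (js.map s)) (K none), Spells G u ∧ u ≠ [] := by
  obtain ⟨⟨cs, hcs⟩, hf⟩ := (mem_grammar_language s).1 hG
  obtain ⟨u, hu, hsp, hne⟩ := (cGen_sound hP hK cs).2.1 _ _ _ hcs hf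
  exact ⟨rounds cs, u, hu, hsp, hne rfl⟩

theorem grammar_generatesStringGraphs (hP : ∀ i, (P i).Generates (K i))
    (hK : ∀ j a, K (some (j, a)) = s j a) : (grammar s P).GeneratesStringGraphs := by
  intro G hG
  obtain ⟨-, u, -, hsp, -⟩ := exists_spells_of_mem_language hP hK hG
  exact ⟨_, hsp⟩

theorem mem_grammar_strings (hP : ∀ i, (P i).Generates (K i))
    (hK : ∀ j a, K (some (j, a)) = s j a) {w : List (IterLabel P)} :
    w ∈ (grammar s P).strings ↔ ∃ js : List J,
      ∃ u ∈ substImage (substComp (js.map s)) (K none), u ≠ [] ∧ u.map .final = w := by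
  constructor
  · rintro ⟨G, hG, hw⟩
    obtain ⟨js, u, hu, hsp, hne⟩ := exists_spells_of_mem_language hP hK hG
    exact ⟨js, u, hu, hne, Represents.unique hsp hw⟩
  · rintro ⟨js, u, hu, hne, rfl⟩
    obtain ⟨cs, G, hG, hsp⟩ := exists_yields_start hP hK js hne hu
    exact ⟨G, (mem_grammar_language s).2 ⟨⟨cs, hG⟩, isFinal_of_spells hsp⟩, hsp⟩

/-- The letters of the final string as labels. -/
def finalEmb (P : Option (J × α) → Presentation α) : α ↪ IterLabel P :=
  ⟨.final, fun _ _ h => by cases h; rfl⟩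

theorem grammar_strings_eq_iter {S : Set (α → Language α)} [Finite S] {L : Language α}
    {P : Option (S × α) → Presentation α} (hL : (P none).Generates L)
    (hS : ∀ h a, (P (some (h, a))).Generates (h.1 a)) :
    (grammar Subtype.val P).GeneratesStringGraphs ∧
      (grammar Subtype.val P).strings = {w | ∃ u ∈ ITER S L, u ≠ [] ∧ u.map (finalEmb P) = w} := by
  have hP : ∀ i, (P i).Generates (i.elim L fun p => p.1.1 p.2) := by
    rintro (_ | ⟨h, a⟩)
    exacts [hL, hS h a]
  refine ⟨grammar_generatesStringGraphs hP fun _ _ => rfl, Set.ext fun w => ?_⟩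
  refine (mem_grammar_strings hP fun _ _ => rfl).trans ⟨?_, ?_⟩
  · rintro ⟨js, u, hu, h⟩
    exact ⟨u, mem_iter_iff.2 ⟨js, hu⟩, h⟩
  · rintro ⟨u, hu, h⟩
    obtain ⟨js, hu⟩ := mem_iter_iff.1 hu
    exact ⟨js, u, hu, h⟩

end IterGrammar

/-! ### The closure theorem. -/

theorem IsPHRS.exists_presentation {α : Type u} {k : ℕ} {L : Language α} (h : IsPHRS k L) :
    ∃ P : Presentation α, P.Generates L ∧ P.grammar.HasOrder k := by
  obtain ⟨l, -, Λ, hΛ, ty, ι, G, h1, -, h2, h3⟩ := h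
  exact ⟨⟨Λ, hΛ, ty, ι, G⟩, ⟨h2, h3⟩, h1⟩

theorem IsRFPHRS.exists_presentation {α : Type u} {k : ℕ} {L : Language α} (h : IsRFPHRS k L) :
    ∃ P : Presentation α, P.Generates L ∧ P.grammar.HasOrder k ∧ P.grammar.RepetitionFree := by
  obtain ⟨l, -, Λ, hΛ, ty, ι, G, h0, h1, -, h2, h3⟩ := h
  exact ⟨⟨Λ, hΛ, ty, ι, G⟩, ⟨h2, h3⟩, h1, h0⟩

open IterGrammar in
theorem mainTheorem7 {α : Type u} [Finite α] (k : ℕ) (hk : 2 ≤ k) (L : Language α)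
    (H : Set (α → Language α)) (hH : H.Finite) :
    (IsPHRS k L → (∀ h ∈ H, IsSubstitution (IsPHRS k) h) → IsPHRS k (ITER H L)) ∧
    (IsRFPHRS k L → (∀ h ∈ H, IsSubstitution (IsRFPHRS k) h ∧ NonErasing h) →
      IsRFPHRS k (ITER H L)) := by
  have := hH.to_subtype
  constructor
  · intro hL hS
    obtain ⟨P₀, hP₀, hk₀⟩ := hL.exists_presentation
    choose Q hQ hkQ using fun (h : H) (a : α) => ((hS h.1 h.2) a).2.exists_presentation
    let P : Option (H × α) → Presentation α := fun i => i.elim P₀ fun p => Q p.1 p.2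
    obtain ⟨h1, h2⟩ := grammar_strings_eq_iter (P := P) hP₀ hQ
    refine ⟨max 1 (grammar Subtype.val P).tables.ncard, le_max_left _ _, IterLabel P,
      inferInstance, IterLabel.ty, finalEmb P, grammar Subtype.val P,
      grammar_hasOrder _ hk ?_, le_max_right _ _, h1, h2⟩
    rintro (_ | ⟨h, a⟩)
    exacts [hk₀, hkQ h a]
  · intro hL hS
    obtain ⟨P₀, hP₀, hk₀, hr₀⟩ := hL.exists_presentation
    choose Q hQ hkQ hrQ using fun (h : H) (a : α) => ((hS h.1 h.2).1 a).2.exists_presentation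
    let P : Option (H × α) → Presentation α := fun i => i.elim P₀ fun p => Q p.1 p.2
    obtain ⟨h1, h2⟩ := grammar_strings_eq_iter (P := P) hP₀ hQ
    refine ⟨max 1 (grammar Subtype.val P).tables.ncard, le_max_left _ _, IterLabel P,
      inferInstance, IterLabel.ty, finalEmb P, grammar Subtype.val P,
      grammar_repetitionFree _ ?_ fun h a => (hS h.1 h.2).2 a,
      grammar_hasOrder _ hk ?_, le_max_right _ _, h1, h2⟩
    · rintro (_ | ⟨h, a⟩)
      exacts [hr₀, hrQ h a]
    · rintro (_ | ⟨h, a⟩)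
      exacts [hk₀, hkQ h a]
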